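/- **Setting and notation.** $|\cdot|$ is the Euclidean norm and $\mathbb R_+=[0,\infty)$. A continuous $\alpha:\mathbb R_+\to\mathbb R_+$ is of class $\mathcal P$ if $\alpha(r)>0$ for $r>0$; of class $\mathcal{PD}$ if moreover $\alpha(0)=0$; of class $\mathcal K$ if it is strictly increasing with $\alpha(0)=0$; of class $\mathcal K_\infty$ if moreover it is unbounded. A continuous $\beta:\mathbb R_+\times\mathbb R_+\to\mathbb R_+$ is of class $\mathcal{KL}$ if $\beta(\cdot,t)\in\mathcal K$ for each $t\ge0$ and, for each $s>0$, $\beta(s,\cdot)$ is decreasing with $\lim_{t\to\infty}\beta(s,t)=0$. Consider the system $$\dot x=\rho_s(x,z,d)\,g_s(x,z,d),\qquad \dot z=\rho_f(z,x,w)\,g_f(z,x,w),\tag{S}$$ with $x\in\mathbb R^n$, $z\in\mathbb R^m$, $d\in\mathbb R^p$, $w\in\mathbb R^q$. The maps $g_s:\mathbb R^n\times\mathbb R^m\times\mathbb R^p\to\mathbb R^n$ and $g_f:\mathbb R^m\times\mathbb R^n\times\mathbb R^q\to\mathbb R^m$ are *regular*: locally Lipschitz in $(x,z)$, uniformly for $d$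 (respectively $w$) in bounded sets, and, for each fixed $(x,z)$, Borel measurable and bounded on bounded sets as functions of $d$ (respectively $w$). Inputs $(d,w)$ are measurable and locally essentially bounded functions of $t\ge 0$, and solutions are absolutely continuous functions satisfying (S) for almost every $t$. *Assumption 1.* There is a locally Lipschitz $\varphi:\mathbb R^n\to\mathbb R^m$ with $g_s(0,\varphi(0),0)=0$ and $g_f(\varphi(x),x,0)=0$ for all $x$. Moreover, $g_s$ is continuous at the point $(0,\varphi(0),0)$. *Assumption 2.* There are continuously differentiable $V_s:\mathbb R^n\to\mathbb R_+$, $V_f:\mathbb R^m\times\mathbb R^n\to\mathbb R_+$, functions $\underline\alpha_s,\overline\alpha_s,\gamma_s,\chi_s,\underline\alpha_f,\overline\alpha_f,\chi_f\in\mathcal K_\infty$ and $\alpha_s,\alpha_f,\lambda_{f1},\lambda_{f2}\in\mathcal{PD}$, with $\lambda_{f2}$ nondecreasing, such that for all $x,z,d,w$ $$\underline\alpha_s(|x|)\le V_s(x)\le\overline\alpha_s(|x|),\qquad \underline\alpha_f(|z-\varphi(x)|)\le V_f(z,x)\le\overline\alpha_f(|z-\varphi(x)|),$$ $$V_s(x)\ge\max\{\gamma_s(V_f(z,x)),\chi_s(|d|)\}\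 \Rightarrow\ \frac{\partial V_s(x)}{\partial x}g_s(x,z,d)\le-\alpha_s(V_s(x)),$$ $$V_f(z,x)\ge\chi_f(|w|)\ \Rightarrow\ \frac{\partial V_f(z,x)}{\partial z}g_f(z,x,w)\le-\alpha_f(V_f(z,x)),$$ $$\left|\frac{\partial V_f(z,x)}{\partial x}\right|\le\lambda_{f1}(V_f(z,x))+\lambda_{f2}(V_s(x)).$$ **Theorem.** Let Assumptions 1 and 2 hold. Suppose that there are $\gamma_f\in\mathcal K_\infty$ and a nondecreasing $\overline\rho_s\in\mathcal P$ such that, for all $r>0$, $$\gamma_f(\gamma_s(r))<r\qquad\text{and}\qquad \overline\rho_s(r)\bigl(\lambda_{f1}(r)+\lambda_{f2}(\gamma_f^{-1}(r))\bigr)<\alpha_f(r).$$ Then there is a $\rho_s^0\in\mathcal P$ such that, with $\rho_s(x,z,d)=\rho_s^0(|g_s(x,z,d)|)$ and $\rho_f\equiv1$: 1. $\rho_s g_s$ is again regular in the above sense; 2. there is a $\underline\rho_s\in\mathcal P$ such that for all $x,z,d$: $V_s(x)\ge\max\{\gamma_s(V_f(z,x)),\chi_s(|d|)\}$ implies $\rho_s(x,z,d)\ge\underline\rho_s(V_s(x))$;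 3. (with the given $\gamma_f$, which satisfies $\gamma_f\circ\gamma_s(r)<r$ for all $r>0$, the given $\overline\rho_s$, and $\underline\rho_f\equiv1$) for all $x,z,d,w$: $V_f(z,x)\ge\max\{\gamma_f(V_s(x)),\gamma_f(\chi_s(|d|)),\chi_f(|w|)\}$ implies $\rho_s(x,z,d)|g_s(x,z,d)|\le\overline\rho_s(V_f(z,x))$ and $\rho_f(z,x,w)\ge\underline\rho_f(V_f(z,x))=1$; 4. the system (S) is input-to-state stable with $\xi=(x,z-\varphi(0))$ as the state and $u=(d,w)$ as the input: there are $\beta\in\mathcal{KL}$ and $\chi\in\mathcal K$ such that for each initial state and each input $u$ a solution exists on $[0,\infty)$, and each solution satisfies $|\xi(t)|\le\max\{\beta(|\xi(0)|,t),\chi(\|u\|_{[0,t]})\}$ at all times $t\ge0$ at which it is defined, where $\|u\|_{[0,t]}$ is the essential supremum of $|u|$ over $[0,t]$. -/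

import Mathlib

open Set MeasureTheory Topology
open scoped ENNReal

/-- The real vector space `ℝᵏ` with its Euclidean norm. -/
abbrev Euc (k : ℕ) : Type := EuclideanSpace ℝ (Fin k)

/-- The Euclidean space `ℝᵏ × ℝˡ = ℝᵏ⁺ˡ` of stacked vectors, with its Euclidean norm. -/
abbrev EucProd (k l : ℕ) : Type := WithLp 2 (Euc k × Euc l)

section Comparison

/-! Comparison functions `ℝ₊ → ℝ₊` are represented by functions `ℝ → ℝ` of which only the
restriction to `[0, ∞)` matters. -/

/-- Class `𝒫`: continuous, positive on `(0, ∞)`, nonnegative at `0`. -/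
structure ClassP (a : ℝ → ℝ) : Prop where
  continuousOn : ContinuousOn a (Ici 0)
  pos : ∀ r, 0 < r → 0 < a r
  zero : 0 ≤ a 0

/-- Class `𝒫𝒟`: continuous, positive on `(0, ∞)`, zero at `0`. -/
structure ClassPD (a : ℝ → ℝ) : Prop where
  continuousOn : ContinuousOn a (Ici 0)
  pos : ∀ r, 0 < r → 0 < a r
  zero : a 0 = 0

/-- Class `𝒦`: continuous, strictly increasing, zero at `0`. -/
structure ClassK (a : ℝ → ℝ) : Prop where
  continuousOn : ContinuousOn a (Ici 0)
  strictMono : StrictMonoOn a (Ici 0)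
  zero : a 0 = 0

/-- Class `𝒦_∞`: of class `𝒦` and unbounded. -/
structure ClassKInf (a : ℝ → ℝ) : Prop extends ClassK a where
  unbounded : ∀ M : ℝ, ∃ r, 0 ≤ r ∧ M < a r

/-- Class `𝒦ℒ`; the first argument of `b` is the "space" argument, the second one is time. -/
structure ClassKL (b : ℝ → ℝ → ℝ) : Prop where
  continuousOn : ContinuousOn (fun v : ℝ × ℝ => b v.1 v.2) (Ici 0 ×ˢ Ici 0)
  classK : ∀ t, 0 ≤ t → ClassK (fun s => b s t)
  decreasing : ∀ s, 0 < s → StrictAntiOn (b s) (Ici 0)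
  tendsto : ∀ s, 0 < s → Filter.Tendsto (b s) Filter.atTop (𝓝 0)

/-- The inverse `[0, ∞) → [0, ∞)` of a function of class `𝒦_∞`. -/
noncomputable def kInv (a : ℝ → ℝ) : ℝ → ℝ := Function.invFunOn a (Ici 0)

end Comparison

section Systems

variable {X U Y : Type*}

/-- Standing regularity of a vector field `g ξ u` with state `ξ` and input `u`: locally Lipschitz
in the state, uniformly for inputs in bounded sets, and Borel measurable and locally bounded in
the input. -/
structure RegularField [NormedAddCommGroup X] [NormedAddCommGroup U] [MeasurableSpace U]
    [NormedAddCommGroup Y] [MeasurableSpace Y] (g : X → U → Y) : Prop where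
  measurable : ∀ ξ, Measurable (g ξ)
  bounded : ∀ (ξ : X) (R : ℝ), ∃ C : ℝ, ∀ u, ‖u‖ ≤ R → ‖g ξ u‖ ≤ C
  lipschitz : ∀ (ξ₀ : X) (R : ℝ), ∃ L : ℝ, ∃ N ∈ 𝓝 ξ₀, ∀ ξ ∈ N, ∀ ξ' ∈ N, ∀ u, ‖u‖ ≤ R →
    ‖g ξ u - g ξ' u‖ ≤ L * ‖ξ - ξ'‖

/-- Input signals: (a.e.) measurable and locally essentially bounded on `[0, ∞)`. -/
def IsInput [NormedAddCommGroup U] (u : ℝ → U) : Prop :=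
  ∀ T : ℝ, MemLp u ∞ (volume.restrict (Icc 0 T))

/-- The essential supremum of `|u|` over `[0, t]`. -/
noncomputable def inputSup [NormedAddCommGroup U] (u : ℝ → U) (t : ℝ) : ℝ :=
  (eLpNorm u ∞ (volume.restrict (Icc 0 t))).toReal

/-- `ξ` is a (Carathéodory, i.e. absolutely continuous) solution of `ξ' = F ξ u` on `[0, T]`. -/
def IsSolutionOn [NormedAddCommGroup X] [NormedSpace ℝ X]
    (F : X → U → X) (u : ℝ → U) (ξ : ℝ → X) (T : ℝ) : Prop :=
  ContinuousOn ξ (Icc 0 T) ∧ ∀ t ∈ Icc 0 T,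
    IntervalIntegrable (fun s => F (ξ s) (u s)) volume 0 t ∧
      ξ t = ξ 0 + ∫ s in (0 : ℝ)..t, F (ξ s) (u s)

/-- Input-to-state stability of `ξ' = F ξ u` with `ξ - e` as the state and `u` as the input:
for each initial state and each input there is a solution on all of `[0, ∞)`, and all solutions
satisfy the ISS estimate. By causality the essential supremum of `|u|` over `[0, ∞)` can be
replaced by the one over `[0, t]`, which is finite for each locally essentially bounded `u`. -/
def IsISS [NormedAddCommGroup X] [NormedSpace ℝ X] [NormedAddCommGroup U]
    (F : X → U → X) (e : X) : Prop :=
  ∃ (β : ℝ → ℝ → ℝ) (χ : ℝ → ℝ), ClassKL β ∧ ClassK χ ∧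
    (∀ (ξ₀ : X) (u : ℝ → U), IsInput u →
      ∃ ξ : ℝ → X, ξ 0 = ξ₀ ∧ ∀ T, 0 ≤ T → IsSolutionOn F u ξ T) ∧
    (∀ (u : ℝ → U) (ξ : ℝ → X) (T : ℝ), IsInput u → IsSolutionOn F u ξ T →
      ∀ t ∈ Icc 0 T, ‖ξ t - e‖ ≤ max (β ‖ξ 0 - e‖ t) (χ (inputSup u t)))

end Systems

section SingularPerturbation

variable {n m p q : ℕ}

/-- The right-hand side of `x' = ρ_s(x,z,d) g_s(x,z,d)`, `z' = ρ_f(z,x,w) g_f(z,x,w)`, with state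
`(x, z)` and input `(d, w)`. -/
noncomputable def perturbedField (gs : Euc n → Euc m → Euc p → Euc n)
    (gf : Euc m → Euc n → Euc q → Euc m)
    (ρs : Euc n → Euc m → Euc p → ℝ) (ρf : Euc m → Euc n → Euc q → ℝ)
    (ξ : EucProd n m) (u : EucProd p q) : EucProd n m :=
  WithLp.toLp 2
    (ρs ξ.fst ξ.snd u.fst • gs ξ.fst ξ.snd u.fst, ρf ξ.snd ξ.fst u.snd • gf ξ.snd ξ.fst u.snd)

/-- The standing assumption on the data: regular dynamics `g_s`, `g_f`. -/
structure StandingRegularity (gs : Euc n → Euc m → Euc p → Euc n)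
    (gf : Euc m → Euc n → Euc q → Euc m) : Prop where
  slow : RegularField (fun (ξ : Euc n × Euc m) (d : Euc p) => gs ξ.1 ξ.2 d)
  fast : RegularField (fun (ξ : Euc n × Euc m) (w : Euc q) => gf ξ.2 ξ.1 w)

/-- Steady-state assumption, with steady-state map `φ`. -/
structure SteadyState (gs : Euc n → Euc m → Euc p → Euc n)
    (gf : Euc m → Euc n → Euc q → Euc m) (φ : Euc n → Euc m) : Prop where
  locallyLipschitz : LocallyLipschitz φ
  slow : gs 0 (φ 0) 0 = 0
  fast : ∀ x, gf (φ x) x 0 = 0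

/-- Lyapunov assumption on the reduced-order subsystem `x' = g_s(x,z,d)`. -/
structure SlowLyapunov (gs : Euc n → Euc m → Euc p → Euc n)
    (Vs : Euc n → ℝ) (Vf : Euc m → Euc n → ℝ)
    (aLow aUp γs χs αs : ℝ → ℝ) : Prop where
  contDiff : ContDiff ℝ 1 Vs
  nonneg : ∀ x, 0 ≤ Vs x
  classKInf_aLow : ClassKInf aLow
  classKInf_aUp : ClassKInf aUp
  classKInf_γs : ClassKInf γs
  classKInf_χs : ClassKInf χs
  classPD_αs : ClassPD αs
  lower : ∀ x, aLow ‖x‖ ≤ Vs x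
  upper : ∀ x, Vs x ≤ aUp ‖x‖
  decay : ∀ x z d, max (γs (Vf z x)) (χs ‖d‖) ≤ Vs x →
    fderiv ℝ Vs x (gs x z d) ≤ -αs (Vs x)

/-- Lyapunov assumption on the boundary-layer subsystem `z' = g_f(z,x,w)`. -/
structure FastLyapunov (gf : Euc m → Euc n → Euc q → Euc m) (φ : Euc n → Euc m)
    (Vs : Euc n → ℝ) (Vf : Euc m → Euc n → ℝ)
    (aLow aUp χf αf lf1 lf2 : ℝ → ℝ) : Prop where
  contDiff : ContDiff ℝ 1 (fun v : Euc m × Euc n => Vf v.1 v.2)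
  nonneg : ∀ z x, 0 ≤ Vf z x
  classKInf_aLow : ClassKInf aLow
  classKInf_aUp : ClassKInf aUp
  classKInf_χf : ClassKInf χf
  classPD_αf : ClassPD αf
  classPD_lf1 : ClassPD lf1
  classPD_lf2 : ClassPD lf2
  lower : ∀ z x, aLow ‖z - φ x‖ ≤ Vf z x
  upper : ∀ z x, Vf z x ≤ aUp ‖z - φ x‖
  decay : ∀ z x w, χf ‖w‖ ≤ Vf z x →
    fderiv ℝ (fun z' => Vf z' x) z (gf z x w) ≤ -αf (Vf z x)
  cross : ∀ z x, ‖fderiv ℝ (fun x' => Vf z x') x‖ ≤ lf1 (Vf z x) + lf2 (Vs x)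

/-- The lower bound on `ρ_s` where the reduced-order subsystem dissipates. -/
def SlowSpeedLowerBound (Vs : Euc n → ℝ) (Vf : Euc m → Euc n → ℝ) (γs χs : ℝ → ℝ)
    (ρs : Euc n → Euc m → Euc p → ℝ) (ρsLow : ℝ → ℝ) : Prop :=
  ∀ x z d, max (γs (Vf z x)) (χs ‖d‖) ≤ Vs x → ρsLow (Vs x) ≤ ρs x z d

/-- The small-gain condition `γ_f ∘ γ_s < id` on `(0, ∞)`. -/
def SmallGain (γf γs : ℝ → ℝ) : Prop := ∀ r, 0 < r → γf (γs r) < r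

/-- `ρ̄_s (λ_f1 + λ_f2 ∘ γ_f⁻¹) < ρ̲_f α_f` on `(0, ∞)`. -/
def SpeedBalance (γf lf1 lf2 αf ρsUp ρfLow : ℝ → ℝ) : Prop :=
  ∀ r, 0 < r → ρsUp r * (lf1 r + lf2 (kInv γf r)) < ρfLow r * αf r

/-- The bounds on the speeds of the subsystems where the boundary-layer one dominates. -/
def FastSpeedBounds (gs : Euc n → Euc m → Euc p → Euc n)
    (Vs : Euc n → ℝ) (Vf : Euc m → Euc n → ℝ) (γf χs χf : ℝ → ℝ)
    (ρs : Euc n → Euc m → Euc p → ℝ) (ρf : Euc m → Euc n → Euc q → ℝ)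
    (ρsUp ρfLow : ℝ → ℝ) : Prop :=
  ∀ x z d w, max (γf (Vs x)) (max (γf (χs ‖d‖)) (χf ‖w‖)) ≤ Vf z x →
    ρs x z d * ‖gs x z d‖ ≤ ρsUp (Vf z x) ∧ ρfLow (Vf z x) ≤ ρf z x w

end SingularPerturbation

/-! ### Comparison functions and infimal convolutions -/

section ComparisonLemmas

variable {a b : ℝ → ℝ}

/-! The slow dynamics are slowed down by a factor depending only on |g_s|. Where V_f dominates
γ_f(V_s) and γ_f(χ_s(|d|)), smallness of V_f forces (x, z, d) towards (0, φ(0), 0), where g_s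
vanishes and is continuous. Hence values of |g_s| near a given r > 0 keep V_f, and with it the
nondecreasing ρ̄_s(V_f), away from zero. An infimal convolution turns this into a 1-Lipschitz κ of
class 𝒫 with κ(|g_s|) ≤ ρ̄_s(V_f) on that region (`exists_speed_profile`). The speed ρ0(s) =
κ(s)/(1+s) satisfies ρ0(s)s ≤ κ(s) and preserves regularity. It does not destroy the slow decay:
where the reduced-order subsystem dissipates, ∂V_s g_s ≤ -α_s(V_s) keeps |g_s| away from zero on
shells of V_s, so ρ0(|g_s|) has a positive lower bound there (`exists_slowSpeedLowerBound`).

Stability rests on W = max(P(V_s), Q(V_f)) with P(r) = r + γ_f(r) and Q(r) = r + γ_f⁻¹(r). Because Q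
∘ γ_f = P, the branches tie exactly on V_f = γ_f(V_s); because P and Q are expansive, decay of V_s
and V_f passes to W without differentiating γ_f. Above a level set by the inputs, the small-gain
condition makes V_s dissipate when V_f ≤ γ_f(V_s), and the speed balance makes α_f outweigh the
drift of V_f caused by x when V_f > γ_f(V_s). This bounds the right slopes of W (`small_gain_dini`),
and a rescaling ψ converts the bound into exponential decay of ψ(W) down to the input level
(`dini_decay`).

Comparing W with the distance to the equilibrium (`exists_classKInf_composite_bounds`) yields the
ISS estimate. The same estimate is an a priori bound, from which truncation and uniqueness give
solutions on [0, ∞) (`exists_global_solution`). -/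

theorem ClassK.nonneg (h : ClassK a) {r : ℝ} (hr : 0 ≤ r) : 0 ≤ a r := by
  rw [← h.zero]
  exact h.strictMono.monotoneOn self_mem_Ici hr hr

theorem ClassK.pos (h : ClassK a) {r : ℝ} (hr : 0 < r) : 0 < a r := by
  rw [← h.zero]
  exact h.strictMono self_mem_Ici hr.le hr

theorem ClassK.mapsTo (h : ClassK a) : MapsTo a (Ici 0) (Ici 0) := fun _ hr => h.nonneg hr

theorem ClassK.lt_iff (h : ClassK a) {r s : ℝ} (hr : 0 ≤ r) (hs : 0 ≤ s) : a r < a s ↔ r < s :=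
  h.strictMono.lt_iff_lt hr hs

theorem ClassPD.nonneg (h : ClassPD a) {r : ℝ} (hr : 0 ≤ r) : 0 ≤ a r := by
  rcases hr.eq_or_lt with rfl | hr
  · exact h.zero.ge
  · exact (h.pos r hr).le

theorem ClassP.nonneg (h : ClassP a) {r : ℝ} (hr : 0 ≤ r) : 0 ≤ a r := by
  rcases hr.eq_or_lt with rfl | hr
  · exact h.zero
  · exact (h.pos r hr).le

/-- A function of class `𝒦_∞` extends to an order isomorphism of the real line. -/
theorem ClassKInf.exists_orderIso (h : ClassKInf a) :
    ∃ e : ℝ ≃o ℝ, e 0 = 0 ∧ ∀ r, 0 ≤ r → e r = a r := by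
  -- The extension is the identity on the negative axis. The inverse of an order isomorphism of the
  -- whole line is automatically continuous.
  let A : ℝ → ℝ := fun r => a (max r 0) + min r 0
  have hA : StrictMono A := by
    intro r s hrs
    have h1 : a (max r 0) ≤ a (max s 0) :=
      h.strictMono.monotoneOn (mem_Ici.2 (le_max_right _ _)) (mem_Ici.2 (le_max_right _ _))
        (max_le_max_right _ hrs.le)
    rcases le_or_gt 0 s with hs | hs
    · rcases le_or_gt 0 r with hr | hr
      · have := h.strictMono hr hs hrs
        simpa [A, hr, hs] using this
      · have : min r 0 < min s 0 := by simpa [hr.le, hs] using hr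
        exact add_lt_add_of_le_of_lt h1 this
    · have : min r 0 < min s 0 := by simpa [hs.le, (hrs.trans hs).le] using hrs
      exact add_lt_add_of_le_of_lt h1 this
  have hsurj : Function.Surjective A := by
    intro y
    rcases le_or_gt 0 y with hy | hy
    · obtain ⟨R, hR, hyR⟩ := h.unbounded y
      have hc : ContinuousOn a (Icc 0 R) := h.continuousOn.mono Icc_subset_Ici_self
      obtain ⟨r, hr, hry⟩ := intermediate_value_Icc hR hc
        (show y ∈ Icc (a 0) (a R) from ⟨by rw [h.zero]; exact hy, hyR.le⟩)
      exact ⟨r, by simp [A, hr.1, hry]⟩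
    · exact ⟨y, by simp [A, hy.le, h.zero]⟩
  refine ⟨hA.orderIsoOfSurjective A hsurj, ?_, fun r hr => ?_⟩
  · simp [A, h.zero]
  · simp [A, hr]

/-- On [0, ∞) the chosen inverse agrees with the inverse of the order isomorphism extending `a`,
which supplies continuity and monotonicity. -/
theorem ClassKInf.kInv_spec (h : ClassKInf a) :
    ClassKInf (kInv a) ∧ (∀ r, 0 ≤ r → a (kInv a r) = r) ∧ (∀ r, 0 ≤ r → kInv a (a r) = r) := by
  obtain ⟨e, he0, he⟩ := h.exists_orderIso
  have hs0 : e.symm 0 = 0 := by rw [OrderIso.symm_apply_eq, he0]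
  have hs : ∀ r, 0 ≤ r → 0 ≤ e.symm r := fun r hr => by
    rw [← hs0]; exact e.symm.monotone hr
  have hinv : ∀ r, 0 ≤ r → a (kInv a r) = r ∧ 0 ≤ kInv a r := by
    intro r hr
    have hex : ∃ t ∈ Ici (0 : ℝ), a t = r :=
      ⟨e.symm r, hs r hr, by rw [← he _ (hs r hr), e.apply_symm_apply]⟩
    exact ⟨Function.invFunOn_eq hex, Function.invFunOn_mem hex⟩
  have heq : ∀ r, 0 ≤ r → kInv a r = e.symm r := by
    intro r hr
    obtain ⟨h1, h2⟩ := hinv r hr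
    rw [← he _ h2] at h1
    rw [OrderIso.eq_symm_apply, h1]
  refine ⟨⟨⟨?_, ?_, ?_⟩, ?_⟩, fun r hr => (hinv r hr).1, ?_⟩
  · exact (e.symm.continuous.continuousOn).congr fun r hr => heq r hr
  · exact (e.symm.strictMono.strictMonoOn _).congr fun r hr => (heq r hr).symm
  · rw [heq 0 le_rfl, hs0]
  · intro M
    refine ⟨e (max M 0 + 1), ?_, ?_⟩
    · rw [← he0]; exact e.monotone (by positivity)
    · rw [heq _ (by rw [← he0]; exact e.monotone (by positivity)), e.symm_apply_apply]
      linarith [le_max_left M 0]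
  · intro r hr
    rw [heq _ (h.toClassK.nonneg hr), ← he r hr, e.symm_apply_apply]

theorem ClassKInf.inv (h : ClassKInf a) : ClassKInf (kInv a) := h.kInv_spec.1

theorem ClassKInf.apply_kInv (h : ClassKInf a) {r : ℝ} (hr : 0 ≤ r) : a (kInv a r) = r :=
  h.kInv_spec.2.1 r hr

theorem ClassKInf.kInv_apply (h : ClassKInf a) {r : ℝ} (hr : 0 ≤ r) : kInv a (a r) = r :=
  h.kInv_spec.2.2 r hr

theorem ClassKInf.le_kInv (h : ClassKInf a) {r s : ℝ} (hr : 0 ≤ r) (hs : 0 ≤ s)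
    (hrs : a r ≤ s) : r ≤ kInv a s := by
  rw [← h.kInv_apply hr]
  exact h.inv.strictMono.monotoneOn (h.toClassK.nonneg hr) hs hrs

theorem ClassK.comp (ha : ClassK a) (hb : ClassK b) : ClassK (fun r => a (b r)) :=
  ⟨ha.continuousOn.comp hb.continuousOn hb.mapsTo,
    ha.strictMono.comp hb.strictMono hb.mapsTo, by simp [hb.zero, ha.zero]⟩

theorem ClassK.sup (ha : ClassK a) (hb : ClassK b) : ClassK (fun r => max (a r) (b r)) :=
  ⟨ha.continuousOn.sup hb.continuousOn,
    fun _ hr _ hs hrs => max_lt_max (ha.strictMono hr hs hrs) (hb.strictMono hr hs hrs),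
    by simp [ha.zero, hb.zero]⟩

theorem ClassKInf.id_add (ha : ClassKInf a) : ClassKInf (fun r => r + a r) :=
  ⟨⟨continuousOn_id.add ha.continuousOn,
    fun _ hr _ hs hrs => add_lt_add hrs (ha.strictMono hr hs hrs), by simp [ha.zero]⟩,
    fun M => by
      obtain ⟨r, hr, hM⟩ := ha.unbounded M
      exact ⟨r, hr, by linarith⟩⟩

/-- If `f` is bounded, respectively small, where `g` is bounded, respectively small, then `g` is
bounded below by a function of class `𝒦_∞` of `f`. -/
theorem exists_classKInf_le {α : Type*} [Nonempty α] (f g : α → ℝ) (hf : ∀ x, 0 ≤ f x)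
    (hg : ∀ x, 0 ≤ g x)
    (hbig : ∀ R, ∃ M, ∀ x, g x ≤ R → f x ≤ M)
    (hsmall : ∀ ε, 0 < ε → ∃ δ, 0 < δ ∧ ∀ x, g x ≤ δ → f x ≤ ε) :
    ∃ κ, ClassKInf κ ∧ ∀ x, κ (f x) ≤ g x := by
  -- Infimal convolution with the positive part: nondecreasing, 1-Lipschitz and at most `g x` at `f
  -- x`, with no regularity of `f` or `g`. Positivity comes from `hsmall`, unboundedness from
  -- `hbig`.
  let k : ℝ → ℝ := fun s => ⨅ x, (g x + max 0 (s - f x))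
  have hbdd : ∀ s, BddBelow (range fun x => g x + max 0 (s - f x)) := fun s =>
    ⟨0, by rintro _ ⟨x, rfl⟩; have := hg x; positivity⟩
  have hk0 : ∀ s, 0 ≤ k s := fun s => Real.iInf_nonneg fun x => by have := hg x; positivity
  have hmono : Monotone k := fun s t hst => ciInf_mono (hbdd s) fun x => by
    gcongr
  have hLip : LipschitzWith 1 k := by
    refine LipschitzWith.of_le_add fun s t => ?_
    rw [← sub_le_iff_le_add]
    refine le_ciInf fun x => ?_
    have h1 : k s ≤ g x + max 0 (s - f x) := ciInf_le (hbdd s) x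
    have h2 : max 0 (s - f x) ≤ max 0 (t - f x) + dist s t := by
      rw [Real.dist_eq]
      apply max_le
      · positivity
      · linarith [le_max_right 0 (t - f x), le_abs_self (s - t)]
    linarith
  have hle : ∀ x, k (f x) ≤ g x := fun x => (ciInf_le (hbdd _) x).trans (by simp)
  have hpos : ∀ s, 0 < s → 0 < k s := by
    intro s hs
    obtain ⟨δ, hδ, h⟩ := hsmall (s / 2) (by linarith)
    refine (lt_min hδ (half_pos hs)).trans_le (le_ciInf fun x => ?_)
    rcases le_or_gt (g x) δ with hx | hx
    · have := h x hx
      have h3 := le_max_right 0 (s - f x)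
      exact (min_le_right _ _).trans (by linarith [hg x])
    · exact (min_le_left _ _).trans (by linarith [le_max_left 0 (s - f x)])
  have hunb : ∀ R, ∃ s, 0 ≤ s ∧ R ≤ k s := by
    intro R
    obtain ⟨M, hM⟩ := hbig R
    refine ⟨max 0 (M + R), le_max_left _ _, le_ciInf fun x => ?_⟩
    rcases le_or_gt (g x) R with hx | hx
    · have := hM x hx
      linarith [hg x, le_max_right 0 (max 0 (M + R) - f x), le_max_right 0 (M + R)]
    · linarith [le_max_left 0 (max 0 (M + R) - f x)]
  have hfrac : ∀ s : ℝ, 0 ≤ s → s / (1 + s) ≤ 1 := fun s hs => by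
    rw [div_le_one (by positivity)]; linarith
  -- The factor s/(1+s) ≤ 1 makes the function strictly increasing and zero at 0; it is at least 1/2
  -- for s ≥ 1, so unboundedness survives.
  refine ⟨fun s => k s * (s / (1 + s)), ⟨⟨?_, ?_, by simp⟩, ?_⟩, fun x => ?_⟩
  · refine hLip.continuous.continuousOn.mul (continuousOn_id.div (by fun_prop) ?_)
    intro s hs
    have : (0 : ℝ) ≤ s := hs
    positivity
  · intro s hs t ht hst
    have hs' : (0 : ℝ) ≤ s := hs
    have ht' : 0 < t := hs'.trans_lt hst
    refine mul_lt_mul' (hmono hst.le) ?_ (by positivity) (hpos t ht')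
    rw [div_lt_div_iff₀ (by positivity) (by positivity)]
    nlinarith
  · intro R
    obtain ⟨s, hs, hR⟩ := hunb (2 * (max R 0 + 1))
    refine ⟨max s 1, by positivity, ?_⟩
    have h1 : 2 * (max R 0 + 1) ≤ k (max s 1) := hR.trans (hmono (le_max_left _ _))
    have h2 : (1 : ℝ) / 2 ≤ max s 1 / (1 + max s 1) := by
      rw [div_le_div_iff₀ (by norm_num) (by positivity)]
      linarith [le_max_right s 1]
    have h3 : (0 : ℝ) ≤ max R 0 := le_max_right _ _
    nlinarith [le_max_left R 0]
  · exact (mul_le_of_le_one_right (hk0 _) (hfrac _ (hf x))).trans (hle x)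

/-- If `g` is bounded away from zero where `f` is close to a given `r > 0`, then `g` is bounded below
by a Lipschitz function of class `𝒫` of `f`. -/
theorem exists_lipschitz_classP_le {α : Type*} [Nonempty α] (f g : α → ℝ)
    (hg : ∀ x, 0 ≤ g x)
    (hloc : ∀ r, 0 < r → ∃ δ, 0 < δ ∧ ∀ x, |r - f x| ≤ δ → δ ≤ g x) :
    ∃ κ, LipschitzWith 1 κ ∧ ClassP κ ∧ (∀ s, 0 ≤ κ s) ∧ ∀ x, κ (f x) ≤ g x := by
  -- Monotonicity is not wanted here, so the kernel is two-sided. For s > 0 every term is at least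
  -- δ: through `g x` if `f x` is within δ of s, through the distance otherwise.
  let k : ℝ → ℝ := fun s => ⨅ x, (g x + |s - f x|)
  have hbdd : ∀ s, BddBelow (range fun x => g x + |s - f x|) := fun s =>
    ⟨0, by rintro _ ⟨x, rfl⟩; have := hg x; positivity⟩
  have hk0 : ∀ s, 0 ≤ k s := fun s => Real.iInf_nonneg fun x => by have := hg x; positivity
  have hLip : LipschitzWith 1 k := by
    refine LipschitzWith.of_le_add fun s t => ?_
    rw [← sub_le_iff_le_add]
    refine le_ciInf fun x => ?_
    have h1 : k s ≤ g x + |s - f x| := ciInf_le (hbdd s) x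
    have h2 : |s - f x| ≤ |s - t| + |t - f x| := abs_sub_le _ _ _
    rw [Real.dist_eq]
    linarith
  refine ⟨k, hLip, ⟨hLip.continuous.continuousOn, fun s hs => ?_, hk0 0⟩, hk0,
    fun x => (ciInf_le (hbdd _) x).trans (by simp)⟩
  obtain ⟨δ, hδ, h⟩ := hloc s hs
  refine hδ.trans_le (le_ciInf fun x => ?_)
  rcases le_or_gt |s - f x| δ with hx | hx
  · linarith [h x hx, abs_nonneg (s - f x)]
  · linarith [hg x]

end ComparisonLemmas

/-! ### Scalar decay from bounds on right slopes -/

section Decay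

/-- For a positive rate `a`, a function `ψ` of class `𝒦_∞` which turns decay at rate `a` into
exponential decay. -/
theorem exists_classKInf_rescaling (a : ℝ → ℝ) (hc : ContinuousOn a (Ioi 0))
    (hpos : ∀ r, 0 < r → 0 < a r) :
    ∃ ψ ψ' : ℝ → ℝ, ClassKInf ψ ∧
      ∀ r, 0 < r → HasDerivAt ψ (ψ' r) r ∧ 0 < ψ' r ∧ ψ r < ψ' r * a r := by
  -- With ψ = exp ∫₁ʳ b one has ψ' = ψ b. The bound by `a r` gives ψ' a ≥ 2ψ, the 2 providing
  -- strictness. The bound by r gives b ≥ 1/r, hence ψ(r) ≤ r below 1 and ψ(r) ≥ r above 1, that is,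
  -- continuity at 0 and unboundedness.
  let b : ℝ → ℝ := fun r => 2 / min (a r) r
  have hminpos : ∀ r, 0 < r → 0 < min (a r) r := fun r hr => lt_min (hpos r hr) hr
  have hbc : ContinuousOn b (Ioi 0) :=
    continuousOn_const.div (hc.inf continuousOn_id) fun r hr => (hminpos r hr).ne'
  have hbpos : ∀ r, 0 < r → 0 < b r := fun r hr => div_pos two_pos (hminpos r hr)
  have hint : ∀ r s, 0 < r → 0 < s → IntervalIntegrable b volume r s := fun r s hr hs =>
    (hbc.mono fun t ht => (lt_min hr hs).trans_le ht.1).intervalIntegrable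
  let G : ℝ → ℝ := fun r => ∫ t in (1 : ℝ)..r, b t
  have hG : ∀ r, 0 < r → HasDerivAt G (b r) r := fun r hr =>
    intervalIntegral.integral_hasDerivAt_right (hint 1 r one_pos hr)
      (hbc.stronglyMeasurableAtFilter isOpen_Ioi r hr)
      (hbc.continuousAt (Ioi_mem_nhds hr))
  have hGmono : StrictMonoOn G (Ioi 0) := by
    refine strictMonoOn_of_deriv_pos (convex_Ioi 0)
      (fun r hr => (hG r hr).continuousAt.continuousWithinAt) fun r hr => ?_
    rw [interior_Ioi] at hr
    rw [(hG r hr).deriv]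
    exact hbpos r hr
  have hdiff : MonotoneOn (fun r => G r - Real.log r) (Ioi 0) := by
    have hd : ∀ r, 0 < r → HasDerivAt (fun r => G r - Real.log r) (b r - r⁻¹) r := fun r hr =>
      (hG r hr).sub (Real.hasDerivAt_log hr.ne')
    refine monotoneOn_of_deriv_nonneg (convex_Ioi 0)
      (fun r hr => (hd r hr).continuousAt.continuousWithinAt)
      (fun r hr => (hd r (by simpa using hr)).differentiableAt.differentiableWithinAt)
      fun r hr => ?_
    have hr : 0 < r := by simpa using hr
    rw [(hd r hr).deriv, sub_nonneg, inv_eq_one_div,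
      div_le_div_iff₀ hr (hminpos r hr)]
    linarith [min_le_right (a r) r]
  have hG1 : G 1 = 0 := intervalIntegral.integral_same
  let ψ : ℝ → ℝ := fun r => if 0 < r then Real.exp (G r) else 0
  have hψ : ∀ r, 0 < r → ψ r = Real.exp (G r) := fun r hr => if_pos hr
  have hψ0 : ψ 0 = 0 := if_neg (lt_irrefl _)
  have hder : ∀ r, 0 < r → HasDerivAt ψ (Real.exp (G r) * b r) r := fun r hr =>
    (hG r hr).exp.congr_of_eventuallyEq
      (by filter_upwards [Ioi_mem_nhds hr] with s hs using hψ s hs)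
  have hψle : ∀ r, 0 ≤ r → r ≤ 1 → ψ r ≤ r := by
    intro r hr hr1
    rcases hr.eq_or_lt with rfl | hr
    · exact hψ0.le
    · have := hdiff hr (mem_Ioi.2 one_pos) hr1
      simp only [hG1, Real.log_one, sub_zero] at this
      rw [hψ r hr, ← Real.exp_log hr, Real.exp_le_exp, Real.exp_log hr]
      linarith
  have hψge : ∀ r, 1 ≤ r → r ≤ ψ r := by
    intro r hr1
    have hr : 0 < r := by linarith
    have := hdiff (mem_Ioi.2 one_pos) hr hr1
    simp only [hG1, Real.log_one, sub_zero] at this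
    rw [hψ r hr]
    calc r = Real.exp (Real.log r) := (Real.exp_log hr).symm
      _ ≤ _ := Real.exp_le_exp.2 (by linarith)
  have hψnn : ∀ r, 0 ≤ ψ r := fun r => by
    simp only [ψ]; split_ifs <;> positivity
  refine ⟨ψ, fun r => Real.exp (G r) * b r, ⟨⟨?_, ?_, hψ0⟩, ?_⟩, fun r hr => ⟨hder r hr, ?_, ?_⟩⟩
  · intro r hr
    rcases (show (0 : ℝ) ≤ r from hr).eq_or_lt with rfl | hr
    · rw [ContinuousWithinAt, hψ0]
      refine tendsto_of_tendsto_of_tendsto_of_le_of_le' tendsto_const_nhds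
        (Filter.tendsto_id'.2 (nhdsWithin_le_nhds : 𝓝[Ici (0 : ℝ)] 0 ≤ 𝓝 0))
        (Filter.Eventually.of_forall hψnn) ?_
      have h1 : ∀ᶠ r in 𝓝[Ici (0 : ℝ)] 0, r < 1 :=
        nhdsWithin_le_nhds (Iio_mem_nhds one_pos)
      filter_upwards [h1, self_mem_nhdsWithin] with r hr1 hr0
      exact hψle r hr0 hr1.le
    · exact (hder r hr).continuousAt.continuousWithinAt
  · intro r hr s hs hrs
    have hs' : 0 < s := (show (0 : ℝ) ≤ r from hr).trans_lt hrs
    rcases (show (0 : ℝ) ≤ r from hr).eq_or_lt with rfl | hr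
    · rw [hψ0, hψ s hs']; positivity
    · rw [hψ r hr, hψ s hs']
      exact Real.exp_lt_exp.2 (hGmono hr hs' hrs)
  · intro M
    refine ⟨max M 0 + 1, by positivity, ?_⟩
    have := hψge (max M 0 + 1) (by linarith [le_max_right M 0])
    linarith [le_max_left M 0]
  · have := hbpos r hr
    positivity
  · rw [hψ r hr, mul_assoc]
    refine lt_mul_of_one_lt_right (Real.exp_pos _) ?_
    have h1 := hminpos r hr
    simp only [b]
    rw [div_mul_eq_mul_div, one_lt_div h1]
    linarith [min_le_left (a r) r, hpos r hr]

/-- A continuous function whose upper right Dini derivative is at most `-a (W t)` above the level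
`c` decays along the rescaled exponential as long as it stays above `c`. -/
theorem dini_decay {a ψ ψ' : ℝ → ℝ} (hψ : ClassKInf ψ)
    (hpos : ∀ r, 0 < r → 0 < a r)
    (hψ' : ∀ r, 0 < r → HasDerivAt ψ (ψ' r) r ∧ 0 < ψ' r ∧ ψ r < ψ' r * a r)
    {W : ℝ → ℝ} {T c : ℝ} (hc : 0 ≤ c) (hT : 0 ≤ T)
    (hW : ContinuousOn W (Icc 0 T))
    (hdini : ∀ t ∈ Ico 0 T, c < W t → ∀ r, -a (W t) < r → ∃ᶠ s in 𝓝[>] t, slope W t s < r) :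
    W T ≤ max (kInv ψ (Real.exp (-T) * ψ (W 0))) c := by
  by_contra! hcon
  obtain ⟨hcon1, hcon2⟩ := max_lt_iff.1 hcon
  -- the level `c` cannot be crossed upwards
  have habove : ∀ t ∈ Icc 0 T, c < W t := by
    by_contra! hex
    obtain ⟨t₀, ht₀, hWt₀⟩ := hex
    -- From the last time t₁ with W ≤ m onwards, W stays above c, so its slope bound is negative and
    -- W cannot rise from m to `W T`.
    obtain ⟨m, hm1, hm2⟩ := exists_between hcon2
    let S := Icc t₀ T ∩ W ⁻¹' Iic m
    have hcont' : ContinuousOn W (Icc t₀ T) := hW.mono (Icc_subset_Icc_left ht₀.1)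
    have hSc : IsCompact S :=
      isCompact_Icc.of_isClosed_subset (hcont'.preimage_isClosed_of_isClosed isClosed_Icc
        isClosed_Iic) inter_subset_left
    have hSne : S.Nonempty := ⟨t₀, ⟨le_rfl, ht₀.2⟩, hWt₀.trans hm1.le⟩
    obtain ⟨t₁, ht₁, hmax⟩ := hSc.exists_isGreatest hSne
    have ht₁T : t₁ < T := lt_of_le_of_ne ht₁.1.2 fun h => by
      have := ht₁.2; rw [h] at this; exact absurd this (not_le.2 hm2)
    have hgt : ∀ t ∈ Ioc t₁ T, m < W t := fun t ht => by
      by_contra! h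
      exact absurd (hmax ⟨⟨ht₁.1.1.trans ht.1.le, ht.2⟩, h⟩) (not_le.2 ht.1)
    have h0t₁ : 0 ≤ t₁ := ht₀.1.trans ht₁.1.1
    have hWt₁ : W t₁ = m := by
      refine le_antisymm ht₁.2 ?_
      have hcw : ContinuousWithinAt W (Ioc t₁ T) t₁ :=
        (hW t₁ ⟨h0t₁, ht₁.1.2⟩).mono fun s hs => ⟨h0t₁.trans hs.1.le, hs.2⟩
      have : t₁ ∈ closure (Ioc t₁ T) := by
        rw [closure_Ioc ht₁T.ne]; exact ⟨le_rfl, ht₁T.le⟩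
      exact continuousWithinAt_const.closure_le this hcw fun s hs => (hgt s hs).le
    have hge : ∀ t ∈ Icc t₁ T, c < W t := fun t ht => by
      rcases ht.1.eq_or_lt with h | h
      · rw [← h, hWt₁]; exact hm1
      · exact hm1.trans (hgt t ⟨h, ht.2⟩)
    have := image_le_of_liminf_slope_right_lt_deriv_boundary (f' := fun t => -a (W t))
      (B := fun _ => m) (B' := fun _ => 0)
      (hW.mono (Icc_subset_Icc_left h0t₁))
      (fun t ht => hdini t ⟨h0t₁.trans ht.1, ht.2⟩ (hge t ⟨ht.1, ht.2.le⟩)) hWt₁.le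
      (fun _ => hasDerivAt_const _ _)
      (fun t ht _ => neg_lt_zero.2 (hpos _ (hc.trans_lt (hge t ⟨ht.1, ht.2.le⟩))))
      (show T ∈ Icc t₁ T from ⟨ht₁T.le, le_rfl⟩)
    exact absurd this (not_le.2 hm2)
  -- above the level, compare with the solution of the scalar equation
  have hWpos : ∀ t ∈ Icc 0 T, 0 < W t := fun t ht => hc.trans_lt (habove t ht)
  have hmem0 : (0 : ℝ) ∈ Icc 0 T := ⟨le_rfl, hT⟩
  have hW0pos := hWpos 0 hmem0
  set K := ψ (W 0) with hK
  have hKpos : 0 < K := hψ.toClassK.pos hW0pos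
  -- The curve along which ψ decays exactly like e⁻ᵗ, so y' = -ψ(y)/ψ'(y). The comparison needs a
  -- strict inequality only where W = y, and there it is ψ < ψ' a.
  let y : ℝ → ℝ := fun t => kInv ψ (Real.exp (-t) * K)
  have hypos : ∀ t, 0 < y t := fun t => hψ.inv.toClassK.pos (by positivity)
  have hψy : ∀ t, ψ (y t) = Real.exp (-t) * K := fun t => hψ.apply_kInv (by positivity)
  have hycont : Continuous y := by
    refine hψ.inv.continuousOn.comp_continuous (by fun_prop) fun t => ?_
    exact mem_Ici.2 (by positivity)
  have hyder : ∀ t, HasDerivAt y (-(ψ (y t) / ψ' (y t))) t := by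
    intro t
    have h1 : HasDerivAt (fun t => Real.exp (-t) * K) (-(Real.exp (-t) * K)) t := by
      have := ((hasDerivAt_neg t).exp.mul_const K)
      simpa using this
    have h2 : HasDerivAt (kInv ψ) (ψ' (y t))⁻¹ (Real.exp (-t) * K) := by
      refine HasDerivAt.of_local_left_inverse (f := ψ) ?_ (hψ' (y t) (hypos t)).1
        (hψ' (y t) (hypos t)).2.1.ne' ?_
      · exact hψ.inv.continuousOn.continuousAt (Ici_mem_nhds (by positivity))
      · filter_upwards [Ioi_mem_nhds (show 0 < Real.exp (-t) * K by positivity)] with s hs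
        exact hψ.apply_kInv (le_of_lt hs)
    have := h2.comp t h1
    rw [hψy, show -(Real.exp (-t) * K / ψ' (y t)) = (ψ' (y t))⁻¹ * -(Real.exp (-t) * K) by ring]
    exact this
  have := image_le_of_liminf_slope_right_lt_deriv_boundary (f' := fun t => -a (W t))
      hW (fun t ht => hdini t ht (habove t ⟨ht.1, ht.2.le⟩))
      (B := y) (B' := fun t => -(ψ (y t) / ψ' (y t)))
      (by simp only [y, neg_zero, Real.exp_zero, one_mul, hK, hψ.kInv_apply hW0pos.le, le_refl])
      hyder
      (fun t ht hWy => by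
        obtain ⟨_, h2, h3⟩ := hψ' (y t) (hypos t)
        rw [hWy, neg_lt_neg_iff, div_lt_iff₀ h2]
        linarith)
      (show T ∈ Icc 0 T from ⟨hT, le_rfl⟩)
  exact absurd this (not_le.2 hcon1)

theorem ClassK.classKL_exp {A B : ℝ → ℝ} (hA : ClassK A) (hB : ClassK B) :
    ClassKL (fun s t => A (Real.exp (-t) * B s)) := by
  refine ⟨?_, fun t ht => ?_, fun s hs => ?_, fun s hs => ?_⟩
  · refine hA.continuousOn.comp (f := fun v : ℝ × ℝ => Real.exp (-v.2) * B v.1) ?_ fun v hv => ?_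
    · refine ContinuousOn.mul (by fun_prop) ?_
      exact hB.continuousOn.comp continuousOn_fst fun v hv => hv.1
    · have := hB.nonneg hv.1
      exact mem_Ici.2 (by positivity)
  · refine hA.comp ⟨continuousOn_const.mul hB.continuousOn, fun r hr s hs hrs => ?_,
      by simp [hB.zero]⟩
    have := hB.strictMono hr hs hrs
    gcongr
  · intro r hr t ht hrt
    have hp := hB.pos hs
    refine hA.strictMono (mem_Ici.2 (by positivity)) (mem_Ici.2 (by positivity)) ?_
    gcongr
  · have hp := hB.pos hs
    have h3 : Filter.Tendsto (fun t => Real.exp (-t) * B s) Filter.atTop (𝓝[Ici 0] 0) := by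
      refine tendsto_nhdsWithin_iff.2 ⟨?_, Filter.Eventually.of_forall fun t => ?_⟩
      · simpa using (Real.tendsto_exp_neg_atTop_nhds_zero).mul_const (B s)
      · exact mem_Ici.2 (by positivity)
    have h4 := (hA.continuousOn 0 self_mem_Ici).tendsto.comp h3
    simpa [Function.comp_def, hA.zero] using h4

end Decay

/-! ### Carathéodory equations and Lyapunov decrease along curves -/

section Caratheodory

variable {X : Type*} [NormedAddCommGroup X] [NormedSpace ℝ X]

/-- In the norm weighted by exp(-(2L+1)t), integration gains the factor L/(2L+1) ≤ 1/2; this drives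
both existence and uniqueness. The summand 1 keeps the exponent positive when L = 0. -/
theorem integral_exp_weight_le {L D t : ℝ} (hL : 0 ≤ L) (hD : 0 ≤ D) :
    ∫ s in (0 : ℝ)..t, L * (Real.exp ((2 * L + 1) * s) * D) ≤
      Real.exp ((2 * L + 1) * t) * (D / 2) := by
  have hl : 0 < 2 * L + 1 := by positivity
  rw [intervalIntegral.integral_const_mul, intervalIntegral.integral_mul_const,
    intervalIntegral.integral_comp_mul_left (fun s => Real.exp s) hl.ne', integral_exp]
  simp only [mul_zero, Real.exp_zero, smul_eq_mul]
  set E := Real.exp ((2 * L + 1) * t)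
  have hE : 0 < E := Real.exp_pos _
  rw [show L * ((2 * L + 1)⁻¹ * (E - 1) * D) = L * (E - 1) * D / (2 * L + 1) by
    field_simp, div_le_iff₀ hl]
  nlinarith [mul_nonneg hL hD, mul_nonneg hE.le hD]

/-- Global solvability of `ξ' = f t ξ` in the sense of Carathéodory, for bounded `f` which is
Lipschitz in the state. -/
theorem exists_caratheodory_solution [CompleteSpace X] (f : ℝ → X → X) {T L K : ℝ} (hT : 0 ≤ T)
    (hL0 : 0 ≤ L)
    (hmeas : ∀ v : ℝ → X, Continuous v →
      AEStronglyMeasurable (fun s => f s (v s)) (volume.restrict (Icc 0 T)))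
    (hL : ∀ᵐ s ∂volume.restrict (Icc 0 T), ∀ x y, ‖f s x - f s y‖ ≤ L * ‖x - y‖)
    (hK : ∀ᵐ s ∂volume.restrict (Icc 0 T), ∀ x, ‖f s x‖ ≤ K) (ξ₀ : X) :
    ∃ ξ : ℝ → X, Continuous ξ ∧ ∀ t ∈ Icc 0 T,
      IntervalIntegrable (fun s => f s (ξ s)) volume 0 t ∧
      ξ t = ξ₀ + ∫ s in (0 : ℝ)..t, f s (ξ s) := by
  set l := 2 * L + 1 with hl
  -- The fixed-point unknown is v(s) = exp(-ls) ξ(s). In this variable the plain sup norm is the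
  -- weighted one, and the Picard map contracts on all of [0, T] at once.
  let ex : C(Icc (0 : ℝ) T, X) → ℝ → X := fun v s => Real.exp (l * s) • v (projIcc 0 T hT s)
  have hex : ∀ v, Continuous (ex v) := fun v =>
    (by fun_prop : Continuous fun s : ℝ => Real.exp (l * s)).smul
      (v.continuous.comp continuous_projIcc)
  have hint : ∀ v : ℝ → X, Continuous v → IntegrableOn (fun s => f s (v s)) (Icc 0 T) := by
    intro v hv
    refine Integrable.of_bound (hmeas v hv) K ?_
    filter_upwards [hK] with s hs using hs _
  have hii : ∀ v : ℝ → X, Continuous v → ∀ t ∈ Icc 0 T,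
      IntervalIntegrable (fun s => f s (v s)) volume 0 t := fun v hv t ht =>
    ((hint v hv).mono_set (by
      rw [uIcc_of_le ht.1]; exact Icc_subset_Icc_right ht.2)).intervalIntegrable
  let Ψ : C(Icc (0 : ℝ) T, X) → C(Icc (0 : ℝ) T, X) := fun v =>
    ⟨fun t => Real.exp (-(l * t)) • (ξ₀ + ∫ s in (0 : ℝ)..t, f s (ex v s)), by
      have h1 : ContinuousOn (fun t => ∫ s in (0 : ℝ)..t, f s (ex v s)) (Icc 0 T) := by
        have := intervalIntegral.continuousOn_primitive_interval
          (f := fun s => f s (ex v s)) (a := 0) (b := T) (μ := volume)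
          (by rw [uIcc_of_le hT]; exact hint _ (hex v))
        rwa [uIcc_of_le hT] at this
      have h2 := continuousOn_iff_continuous_domRestrict.1 h1
      exact (by fun_prop : Continuous fun t : Icc (0 : ℝ) T => Real.exp (-(l * t))).smul
        (continuous_const.add h2)⟩
  have hΨ : ∀ v t, Ψ v t = Real.exp (-(l * t)) • (ξ₀ + ∫ s in (0 : ℝ)..t, f s (ex v s)) :=
    fun _ _ => rfl
  have hLip : ∀ v w, dist (Ψ v) (Ψ w) ≤ (1 / 2 : ℝ) * dist v w := by
    intro v w
    rw [ContinuousMap.dist_le (by positivity)]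
    intro t
    have hD : 0 ≤ dist v w := dist_nonneg
    have h1 : ‖∫ s in (0 : ℝ)..t, (f s (ex v s) - f s (ex w s))‖ ≤
        ∫ s in (0 : ℝ)..t, L * (Real.exp (l * s) * dist v w) := by
      refine intervalIntegral.norm_integral_le_of_norm_le t.2.1 ?_
        (Continuous.intervalIntegrable (by fun_prop) _ _)
      have := (ae_restrict_iff' measurableSet_Icc).1 hL
      filter_upwards [this] with s hs hst
      refine (hs ⟨hst.1.le, hst.2.trans t.2.2⟩ _ _).trans ?_
      gcongr
      rw [← smul_sub, norm_smul, Real.norm_of_nonneg (Real.exp_pos _).le, ← dist_eq_norm]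
      gcongr
      exact ContinuousMap.dist_apply_le_dist _
    rw [intervalIntegral.integral_sub (hii _ (hex v) t t.2) (hii _ (hex w) t t.2)] at h1
    rw [dist_eq_norm, hΨ, hΨ, ← smul_sub, add_sub_add_left_eq_sub, norm_smul,
      Real.norm_of_nonneg (Real.exp_pos _).le]
    calc _ ≤ Real.exp (-(l * t)) * (Real.exp (l * t) * (dist v w / 2)) := by
          gcongr
          exact h1.trans (integral_exp_weight_le hL0 hD)
      _ = _ := by rw [← mul_assoc, ← Real.exp_add]; simp; ring
  have hcontr : ContractingWith (1 / 2 : NNReal) Ψ := by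
    refine ⟨by rw [← NNReal.coe_lt_coe]; norm_num, LipschitzWith.of_dist_le_mul fun v w => ?_⟩
    simpa using hLip v w
  have : Nonempty C(Icc (0 : ℝ) T, X) := ⟨0⟩
  obtain ⟨v, hv⟩ : ∃ v, Ψ v = v := ⟨_, hcontr.fixedPoint_isFixedPt⟩
  refine ⟨ex v, hex v, fun t ht => ⟨hii _ (hex v) t ht, ?_⟩⟩
  have h1 := hΨ v ⟨t, ht⟩
  rw [hv] at h1
  simp only [ex] at h1 ⊢
  rw [projIcc_of_mem hT ht, h1, smul_smul, ← Real.exp_add, add_neg_cancel, Real.exp_zero, one_smul]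

/-- At a maximum point of the weighted distance, the integral equation bounds that distance by half
of itself. The Lipschitz bound is needed only along the two curves. -/
theorem caratheodory_solution_unique {f : ℝ → X → X} {T L : ℝ} (hL0 : 0 ≤ L) {ξ η : ℝ → X}
    (hξc : ContinuousOn ξ (Icc 0 T)) (hηc : ContinuousOn η (Icc 0 T)) {ξ₀ : X}
    (hξ : ∀ t ∈ Icc 0 T, IntervalIntegrable (fun s => f s (ξ s)) volume 0 t ∧
      ξ t = ξ₀ + ∫ s in (0 : ℝ)..t, f s (ξ s))
    (hη : ∀ t ∈ Icc 0 T, IntervalIntegrable (fun s => f s (η s)) volume 0 t ∧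
      η t = ξ₀ + ∫ s in (0 : ℝ)..t, f s (η s))
    (hL : ∀ᵐ s ∂volume.restrict (Icc 0 T), ‖f s (ξ s) - f s (η s)‖ ≤ L * ‖ξ s - η s‖) :
    ∀ t ∈ Icc 0 T, ξ t = η t := by
  intro t ht
  set l := 2 * L + 1 with hl
  let D : ℝ → ℝ := fun s => Real.exp (-(l * s)) * ‖ξ s - η s‖
  have hDc : ContinuousOn D (Icc 0 T) := ContinuousOn.mul (by fun_prop) (hξc.sub hηc).norm
  obtain ⟨r, hr, hmax⟩ := isCompact_Icc.exists_isMaxOn ⟨t, ht⟩ hDc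
  have hD : ∀ s, ‖ξ s - η s‖ = Real.exp (l * s) * D s := fun s => by
    simp only [D]; rw [← mul_assoc, ← Real.exp_add]; simp
  have hDr : 0 ≤ D r := by positivity
  have h1 : ‖∫ s in (0 : ℝ)..r, (f s (ξ s) - f s (η s))‖ ≤
      ∫ s in (0 : ℝ)..r, L * (Real.exp (l * s) * D r) := by
    refine intervalIntegral.norm_integral_le_of_norm_le hr.1 ?_
      (Continuous.intervalIntegrable (by fun_prop) _ _)
    filter_upwards [(ae_restrict_iff' measurableSet_Icc).1 hL] with s hs hst
    have hsT : s ∈ Icc 0 T := ⟨hst.1.le, hst.2.trans hr.2⟩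
    refine (hs hsT).trans ?_
    rw [hD]
    gcongr
    exact hmax hsT
  rw [intervalIntegral.integral_sub (hξ r hr).1 (hη r hr).1] at h1
  have h2 : ‖ξ r - η r‖ ≤ Real.exp (l * r) * (D r / 2) := by
    rw [(hξ r hr).2, (hη r hr).2, add_sub_add_left_eq_sub]
    exact h1.trans (integral_exp_weight_le hL0 hDr)
  rw [hD] at h2
  have h3 : D r ≤ D r / 2 := le_of_mul_le_mul_left h2 (Real.exp_pos _)
  have h4 : D t ≤ 0 := (hmax ht).trans (by linarith)
  have h5 : ‖ξ t - η t‖ ≤ 0 := by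
    rw [hD]; exact mul_nonpos_of_nonneg_of_nonpos (Real.exp_pos _).le h4
  exact sub_eq_zero.1 (norm_le_zero_iff.1 h5)

/-- Decrease of a continuously differentiable function along an absolutely continuous curve. -/
theorem decrease_along_curve [CompleteSpace X] {V : X → ℝ} (hV : ContDiff ℝ 1 V)
    {x f : ℝ → X} {a b c M : ℝ} (hab : a ≤ b)
    (hx : ContinuousOn x (Icc a b)) (hf : IntervalIntegrable f volume a b)
    (hxf : ∀ s ∈ Icc a b, ∀ t ∈ Icc a b, x t - x s = ∫ r in s..t, f r)
    (hM : ∀ᵐ r ∂volume.restrict (Icc a b), ‖f r‖ ≤ M)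
    (hdec : ∀ᵐ r ∂volume.restrict (Icc a b), fderiv ℝ V (x r) (f r) ≤ -c) :
    V (x b) ≤ V (x a) - c * (b - a) := by
  have hVc : Continuous V := hV.continuous
  have hDc : Continuous (fderiv ℝ V) := hV.continuous_fderiv one_ne_zero
  have hM0 : 0 ≤ max M 0 := le_max_right _ _
  -- No almost-everywhere chain rule is used: right slopes of V ∘ x are bounded at every t. The
  -- derivative of V is frozen at `x t` and, being linear, passes under the integral of `f`.
  have key := image_le_of_liminf_slope_right_le_deriv_boundary (f := fun t => V (x t))
    (a := a) (b := b) (hVc.comp_continuousOn hx) (B := fun t => V (x a) - c * (t - a))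
    (B' := fun _ => -c) (by simp) (by fun_prop)
    (fun t _ => by
      have := (((hasDerivAt_id t).sub_const a).const_mul c).const_sub (V (x a))
      simpa using this.hasDerivWithinAt)
    (fun t ht r hr => ?_)
  · exact key ⟨hab, le_rfl⟩
  have hr' : -c < r := hr
  apply Filter.Eventually.frequently
  -- choose a tolerance
  set M' := max M 0 + 1 with hM'
  have hM'pos : 0 < M' := by positivity
  obtain ⟨ε, hε, hεr⟩ : ∃ ε, 0 < ε ∧ -c + 2 * (ε * M') < r := by
    refine ⟨(r + c) / (4 * M'), div_pos (by linarith) (by positivity), ?_⟩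
    rw [div_mul_eq_mul_div, mul_div_mul_right _ _ hM'pos.ne']
    linarith
  have hcw : ContinuousWithinAt x (Icc a b) t := hx t ⟨ht.1, ht.2.le⟩
  have hIoi : 𝓝[>] t ≤ 𝓝[Icc a b] t := nhdsWithin_le_of_mem (Icc_mem_nhdsGT_of_mem ht)
  have hcr : Filter.Tendsto x (𝓝[>] t) (𝓝 (x t)) := hcw.tendsto.mono_left hIoi
  have hdiff : ∀ᶠ y in 𝓝 (x t), ‖V y - V (x t) - fderiv ℝ V (x t) (y - x t)‖ ≤
      ε * ‖y - x t‖ :=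
    ((hV.differentiable one_ne_zero (x t)).hasFDerivAt.isLittleO).def hε
  have hDnear : ∀ᶠ s in 𝓝[Icc a b] t, ‖fderiv ℝ V (x s) - fderiv ℝ V (x t)‖ < ε := by
    have : Filter.Tendsto (fun s => fderiv ℝ V (x s)) (𝓝[Icc a b] t) (𝓝 (fderiv ℝ V (x t))) :=
      (hDc.tendsto _).comp hcw.tendsto
    simpa [dist_eq_norm] using Metric.tendsto_nhds.1 this ε hε
  obtain ⟨η, hη, hηD⟩ := Metric.mem_nhdsWithin_iff.1 hDnear
  filter_upwards [hcr.eventually hdiff, self_mem_nhdsWithin,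
    Ioo_mem_nhdsGT (show t < min b (t + η) from lt_min ht.2 (by linarith))] with s hs1 hs2 hs3
  have hts : t < s := hs2
  have hsb : s < b := hs3.2.trans_le (min_le_left _ _)
  have hsη : s < t + η := hs3.2.trans_le (min_le_right _ _)
  have htI : t ∈ Icc a b := ⟨ht.1, ht.2.le⟩
  have hsI : s ∈ Icc a b := ⟨ht.1.trans hts.le, hsb.le⟩
  have hfi : IntervalIntegrable f volume t s := hf.mono_set (by
    rw [uIcc_of_le hab, uIcc_of_le hts.le]; exact Icc_subset_Icc htI.1 hsI.2)
  have hae : ∀ᵐ r, r ∈ Ioc t s → ‖f r‖ ≤ M' ∧ fderiv ℝ V (x t) (f r) ≤ -c + ε * M' := by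
    filter_upwards [(ae_restrict_iff' measurableSet_Icc).1 hM,
      (ae_restrict_iff' measurableSet_Icc).1 hdec] with r h1 h2 hr
    have hrI : r ∈ Icc a b := ⟨htI.1.trans hr.1.le, hr.2.trans hsI.2⟩
    have h1 : ‖f r‖ ≤ M' := (h1 hrI).trans (by linarith [le_max_left M 0])
    refine ⟨h1, ?_⟩
    have h3 : ‖fderiv ℝ V (x r) - fderiv ℝ V (x t)‖ < ε := hηD ⟨by
      rw [Metric.mem_ball, Real.dist_eq, abs_lt]; constructor <;> linarith [hr.1, hr.2], hrI⟩
    have h4 : ‖(fderiv ℝ V (x r) - fderiv ℝ V (x t)) (f r)‖ ≤ ε * M' :=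
      (ContinuousLinearMap.le_opNorm _ _).trans (by gcongr)
    rw [_root_.sub_apply, Real.norm_eq_abs] at h4
    linarith [neg_abs_le (fderiv ℝ V (x r) (f r) - fderiv ℝ V (x t) (f r)), h2 hrI]
  have hxs : x s - x t = ∫ r in t..s, f r := hxf t htI s hsI
  have hn : ‖x s - x t‖ ≤ M' * (s - t) := by
    rw [hxs]
    have := intervalIntegral.norm_integral_le_of_norm_le_const_ae (a := t) (b := s) (f := f)
      (C := M') (by
        rw [uIoc_of_le hts.le]
        filter_upwards [hae] with r hr hrm using (hr hrm).1)
    rwa [abs_of_pos (by linarith)] at this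
  have hlin : fderiv ℝ V (x t) (x s - x t) ≤ (-c + ε * M') * (s - t) := by
    rw [hxs, ← ContinuousLinearMap.intervalIntegral_comp_comm _ hfi]
    have h5 := intervalIntegral.integral_mono_ae_restrict (μ := volume) hts.le
      (f := fun r => fderiv ℝ V (x t) (f r)) (g := fun _ => -c + ε * M')
      ⟨(fderiv ℝ V (x t)).integrable_comp hfi.1, (fderiv ℝ V (x t)).integrable_comp hfi.2⟩
      intervalIntegrable_const (by
        have h6 : ∀ᵐ r, r ∈ Icc t s → fderiv ℝ V (x t) (f r) ≤ -c + ε * M' := by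
          have h7 : ∀ᵐ r : ℝ, r ≠ t := by simp [ae_iff, measure_singleton]
          filter_upwards [hae, h7] with r hr hrt hrm
          exact (hr ⟨lt_of_le_of_ne hrm.1 (Ne.symm hrt), hrm.2⟩).2
        exact (ae_restrict_iff' measurableSet_Icc).2 h6)
    rw [intervalIntegral.integral_const, smul_eq_mul] at h5
    linarith
  rw [slope_def_field, div_lt_iff₀ (by linarith)]
  -- One ε M' comes from freezing the derivative, the other from the first-order remainder of V.
  have h8 : V (x s) - V (x t) ≤ (-c + ε * M') * (s - t) + ε * (M' * (s - t)) := by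
    have h9 := (le_abs_self _).trans (hs1.trans (mul_le_mul_of_nonneg_left hn hε.le))
    linarith
  nlinarith [mul_pos (sub_pos.2 hεr) (sub_pos.2 hts)]

end Caratheodory

/-! ### Input signals and global solutions -/

section Solutions

variable {U : Type*} [NormedAddCommGroup U]

theorem inputSup_nonneg (u : ℝ → U) (t : ℝ) : 0 ≤ inputSup u t := ENNReal.toReal_nonneg

theorem IsInput.inputSup_mono {u : ℝ → U} (hu : IsInput u) {s t : ℝ} (hst : s ≤ t) :
    inputSup u s ≤ inputSup u t :=
  ENNReal.toReal_mono (hu t).eLpNorm_lt_top.ne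
    (eLpNorm_mono_measure u (Measure.restrict_mono (Icc_subset_Icc_right hst) le_rfl))

theorem IsInput.ae_norm_le {u : ℝ → U} (hu : IsInput u) (t : ℝ) :
    ∀ᵐ s ∂volume.restrict (Icc 0 t), ‖u s‖ ≤ inputSup u t := by
  have h := ae_le_eLpNormEssSup (f := u) (μ := volume.restrict (Icc 0 t))
  filter_upwards [h] with s hs
  rw [← eLpNorm_exponent_top] at hs
  have := ENNReal.toReal_mono (hu t).eLpNorm_lt_top.ne hs
  simpa [inputSup] using this

end Solutions

section Solutions

variable {X U : Type*} [NormedAddCommGroup X] [NormedSpace ℝ X]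
  {F : X → U → X} {u : ℝ → U} {ξ η : ℝ → X} {S T : ℝ}

theorem IsSolutionOn.mono (h : IsSolutionOn F u ξ T) (hST : S ≤ T) : IsSolutionOn F u ξ S :=
  ⟨h.1.mono (Icc_subset_Icc_right hST), fun t ht => h.2 t ⟨ht.1, ht.2.trans hST⟩⟩

theorem IsSolutionOn.congr (h : IsSolutionOn F u ξ T) (hη : ∀ t ∈ Icc 0 T, η t = ξ t) :
    IsSolutionOn F u η T := by
  refine ⟨h.1.congr hη, fun t ht => ?_⟩
  have heq : ∀ s ∈ uIcc 0 t, F (ξ s) (u s) = F (η s) (u s) := fun s hs => by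
    rw [uIcc_of_le ht.1] at hs
    rw [hη s ⟨hs.1, hs.2.trans ht.2⟩]
  obtain ⟨h1, h2⟩ := h.2 t ht
  refine ⟨h1.congr fun s hs => heq s (uIoc_subset_uIcc hs), ?_⟩
  rw [hη t ht, hη 0 ⟨le_rfl, ht.1.trans ht.2⟩, h2, intervalIntegral.integral_congr heq]

/-- Truncation outside a ball suggested by the a priori bound makes the field bounded and globally
Lipschitz, and the truncated solution never leaves the ball where the cutoff is 1. Uniqueness glues
the solutions on the intervals [0, T]. -/
theorem exists_global_solution [NormedAddCommGroup U] [CompleteSpace X] (F : X → U → X) (e : X)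
    (u : ℝ → U) (hu : IsInput u)
    (hmeas : ∀ v : ℝ → X, Continuous v → ∀ T,
      AEStronglyMeasurable (fun s => F (v s) (u s)) (volume.restrict (Icc 0 T)))
    (hbound : ∀ R r, ∃ C, ∀ ξ, ‖ξ - e‖ ≤ R → ∀ u, ‖u‖ ≤ r → ‖F ξ u‖ ≤ C)
    (hLip : ∀ R r, ∃ L, ∀ ξ ξ', ‖ξ - e‖ ≤ R → ‖ξ' - e‖ ≤ R → ∀ u, ‖u‖ ≤ r →
      ‖F ξ u - F ξ' u‖ ≤ L * ‖ξ - ξ'‖)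
    (ξ₀ : X)
    (hprior : ∀ T, ∃ M, ∀ ξ, ∀ t ∈ Icc 0 T, IsSolutionOn F u ξ t → ξ 0 = ξ₀ → ‖ξ t - e‖ ≤ M) :
    ∃ ξ : ℝ → X, ξ 0 = ξ₀ ∧ ∀ T, 0 ≤ T → IsSolutionOn F u ξ T := by
  have hloc : ∀ T, 0 ≤ T → ∃ ξ : ℝ → X, ξ 0 = ξ₀ ∧ IsSolutionOn F u ξ T := by
    intro T hT
    obtain ⟨M₀, hM₀⟩ := hprior T
    set M := max M₀ ‖ξ₀ - e‖ with hM
    obtain ⟨C, hC⟩ := hbound (M + 2) (inputSup u T)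
    obtain ⟨L, hL⟩ := hLip (M + 2) (inputSup u T)
    set C' := max C 0
    set L' := max L 0
    have hC'0 : 0 ≤ C' := le_max_right _ _
    have hL'0 : 0 ≤ L' := le_max_right _ _
    -- Equal to 1 up to radius M + 1 and to 0 beyond M + 2. Genuine solutions stay within M, which
    -- leaves a margin for the exit argument.
    let cut : X → ℝ := fun x => max 0 (min 1 (M + 2 - ‖x - e‖))
    have hcut0 : ∀ x, 0 ≤ cut x := fun x => le_max_left _ _
    have hcut1 : ∀ x, cut x ≤ 1 := fun x => max_le zero_le_one (min_le_left _ _)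
    have hcutc : Continuous cut := by fun_prop
    have hcut_out : ∀ x, M + 2 < ‖x - e‖ → cut x = 0 := fun x hx =>
      max_eq_left ((min_le_right _ _).trans (by linarith))
    have hcut_in : ∀ x, ‖x - e‖ ≤ M + 1 → cut x = 1 := fun x hx => by
      simp only [cut]
      rw [min_eq_left (by linarith), max_eq_right zero_le_one]
    have hcutL : ∀ x y, |cut x - cut y| ≤ ‖x - y‖ := by
      intro x y
      have h1 : |‖x - e‖ - ‖y - e‖| ≤ ‖x - y‖ := by
        simpa using abs_norm_sub_norm_le (x - e) (y - e)
      obtain ⟨h2, h3⟩ := abs_le.1 h1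
      have h4 := norm_nonneg (x - y)
      simp only [cut, abs_le, max_def, min_def]
      split_ifs <;> constructor <;> linarith
    -- Only `x` must lie in the large ball: the difference is split so that `F y v` appears only
    -- with the weight `cut y`, which vanishes outside.
    have hcutF : ∀ x y v, ‖v‖ ≤ inputSup u T → ‖x - e‖ ≤ M + 2 →
        ‖cut x • F x v - cut y • F y v‖ ≤ (C' + L') * ‖x - y‖ := by
      intro x y v hv hx
      have h1 : |cut x - cut y| * ‖F x v‖ ≤ ‖x - y‖ * C' :=
        mul_le_mul (hcutL x y) ((hC x hx v hv).trans (le_max_left _ _)) (norm_nonneg _)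
          (norm_nonneg _)
      rcases le_or_gt ‖y - e‖ (M + 2) with hy | hy
      · have h2 : ‖F x v - F y v‖ ≤ L' * ‖x - y‖ :=
          (hL x y hx hy v hv).trans (by gcongr; exact le_max_left _ _)
        have h3 : cut y * ‖F x v - F y v‖ ≤ L' * ‖x - y‖ :=
          (mul_le_of_le_one_left (norm_nonneg _) (hcut1 y)).trans h2
        calc ‖cut x • F x v - cut y • F y v‖
            = ‖(cut x - cut y) • F x v + cut y • (F x v - F y v)‖ := by
              congr 1; rw [sub_smul, smul_sub]; abel
          _ ≤ |cut x - cut y| * ‖F x v‖ + cut y * ‖F x v - F y v‖ := by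
              refine (norm_add_le _ _).trans ?_
              rw [norm_smul, norm_smul, Real.norm_eq_abs, Real.norm_of_nonneg (hcut0 y)]
          _ ≤ _ := by linarith
      · have h4 : cut y = 0 := hcut_out y hy
        rw [h4, sub_zero] at h1
        rw [h4, zero_smul, sub_zero, norm_smul, Real.norm_eq_abs]
        nlinarith [mul_nonneg hL'0 (norm_nonneg (x - y))]
    obtain ⟨ξ, hξc, hξ⟩ := exists_caratheodory_solution (fun s x => cut x • F x (u s)) hT
      (L := C' + L') (K := C') (by positivity)
      (fun v hv => (hcutc.comp hv).aestronglyMeasurable.smul (hmeas v hv T))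
      (by
        filter_upwards [hu.ae_norm_le T] with s hs x y
        rcases le_or_gt ‖x - e‖ (M + 2) with hx | hx
        · exact hcutF x y _ hs hx
        · rcases le_or_gt ‖y - e‖ (M + 2) with hy | hy
          · rw [norm_sub_rev, norm_sub_rev x]
            exact hcutF y x _ hs hy
          · simp only [hcut_out x hx, hcut_out y hy, zero_smul, sub_zero, norm_zero]
            positivity)
      (by
        filter_upwards [hu.ae_norm_le T] with s hs x
        rcases le_or_gt ‖x - e‖ (M + 2) with hx | hx
        · rw [norm_smul, Real.norm_of_nonneg (hcut0 x)]
          exact (mul_le_of_le_one_left (norm_nonneg _) (hcut1 x)).trans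
            ((hC x hx _ hs).trans (le_max_left _ _))
        · simp [hcut_out x hx, hC'0]) ξ₀
    have hξ0 : ξ 0 = ξ₀ := by simpa using (hξ 0 ⟨le_rfl, hT⟩).2
    have hsol : ∀ S ≤ T, (∀ s ∈ Icc 0 S, ‖ξ s - e‖ ≤ M + 1) → IsSolutionOn F u ξ S := by
      intro S hS hin
      refine ⟨hξc.continuousOn, fun t ht => ?_⟩
      have heq : ∀ s ∈ uIcc 0 t, cut (ξ s) • F (ξ s) (u s) = F (ξ s) (u s) := fun s hs => by
        rw [uIcc_of_le ht.1] at hs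
        rw [hcut_in _ (hin s ⟨hs.1, hs.2.trans ht.2⟩), one_smul]
      obtain ⟨h1, h2⟩ := hξ t ⟨ht.1, ht.2.trans hS⟩
      exact ⟨h1.congr fun s hs => heq s (uIoc_subset_uIcc hs), by
        rw [h2, intervalIntegral.integral_congr heq, hξ0]⟩
    refine ⟨ξ, hξ0, hsol T le_rfl ?_⟩
    by_contra! hex
    obtain ⟨t, ht, hlt⟩ := hex
    have hgc : Continuous fun s => ‖ξ s - e‖ := (hξc.sub continuous_const).norm
    have hSc : IsCompact (Icc 0 T ∩ {s | M + 1 ≤ ‖ξ s - e‖}) :=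
      isCompact_Icc.inter_right (isClosed_le continuous_const hgc)
    -- At the first time of radius M + 1 the curve is still a genuine solution, so the a priori
    -- bound M₀ ≤ M is contradicted.
    obtain ⟨r, hr, hmin⟩ := hSc.exists_isLeast ⟨t, ht, hlt.le⟩
    have hbelow : ∀ s ∈ Ico 0 r, ‖ξ s - e‖ ≤ M + 1 := fun s hs => by
      by_contra! h
      exact absurd (hmin ⟨⟨hs.1, hs.2.le.trans hr.1.2⟩, h.le⟩) (not_le.2 hs.2)
    have hr0 : 0 < r := by
      refine lt_of_le_of_ne hr.1.1 fun h => ?_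
      have h1 : M + 1 ≤ ‖ξ r - e‖ := hr.2
      rw [← h, hξ0] at h1
      linarith [le_max_right M₀ ‖ξ₀ - e‖]
    have hupto : ∀ s ∈ Icc 0 r, ‖ξ s - e‖ ≤ M + 1 := by
      have hcl : closure (Ico 0 r) ⊆ {s | ‖ξ s - e‖ ≤ M + 1} :=
        closure_minimal hbelow (isClosed_le hgc continuous_const)
      rwa [closure_Ico hr0.ne] at hcl
    have h1 := hM₀ ξ r hr.1 (hsol r hr.1.2 hupto) hξ0
    have h2 : M + 1 ≤ ‖ξ r - e‖ := hr.2
    linarith [le_max_left M₀ ‖ξ₀ - e‖]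
  have huniq : ∀ T (ξ η : ℝ → X), IsSolutionOn F u ξ T → IsSolutionOn F u η T → ξ 0 = ξ₀ →
      η 0 = ξ₀ → ∀ t ∈ Icc 0 T, ξ t = η t := by
    intro T ξ η hξ hη hξ0 hη0
    obtain ⟨R₁, hR₁⟩ := isCompact_Icc.exists_bound_of_continuousOn (hξ.1.sub continuousOn_const)
    obtain ⟨R₂, hR₂⟩ := isCompact_Icc.exists_bound_of_continuousOn (hη.1.sub continuousOn_const)
    obtain ⟨L, hL⟩ := hLip (max R₁ R₂) (inputSup u T)
    refine caratheodory_solution_unique (f := fun s x => F x (u s)) (le_max_right L 0) hξ.1 hη.1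
      (ξ₀ := ξ₀) (fun t ht => ?_) (fun t ht => ?_) ?_
    · rw [← hξ0]; exact hξ.2 t ht
    · rw [← hη0]; exact hη.2 t ht
    · filter_upwards [hu.ae_norm_le T, ae_restrict_mem measurableSet_Icc] with s hs hsT
      refine (hL _ _ ((hR₁ s hsT).trans (le_max_left _ _)) ((hR₂ s hsT).trans (le_max_right _ _))
        _ hs).trans ?_
      gcongr
      exact le_max_left _ _
  choose! sol hsol0 hsol using hloc
  refine ⟨fun t => sol t t, hsol0 0 le_rfl, fun T hT => (hsol T hT).congr fun t ht => ?_⟩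
  exact huniq t _ _ (hsol t ht.1) ((hsol T hT).mono ht.2) (hsol0 t ht.1) (hsol0 T hT) t
    ⟨ht.1, le_rfl⟩

end Solutions

/-! ### Regular fields: compact sets, composition, measurability -/

section Regularity

variable {X U Y : Type*} [NormedAddCommGroup X] [NormedAddCommGroup U] [MeasurableSpace U]
  [NormedAddCommGroup Y] [MeasurableSpace Y] {g : X → U → Y}

theorem RegularField.exists_bound_of_isCompact (hg : RegularField g) {K : Set X}
    (hK : IsCompact K) (R : ℝ) : ∃ C, 0 ≤ C ∧ ∀ ξ ∈ K, ∀ u, ‖u‖ ≤ R → ‖g ξ u‖ ≤ C := by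
  refine hK.induction_on (p := fun s => ∃ C, 0 ≤ C ∧ ∀ ξ ∈ s, ∀ u, ‖u‖ ≤ R → ‖g ξ u‖ ≤ C)
    ⟨0, le_rfl, by simp⟩ ?_ ?_ ?_
  · rintro s t hst ⟨C, hC0, hC⟩
    exact ⟨C, hC0, fun ξ hξ => hC ξ (hst hξ)⟩
  · rintro s t ⟨C, hC0, hC⟩ ⟨D, _, hD⟩
    refine ⟨max C D, hC0.trans (le_max_left _ _), ?_⟩
    rintro ξ (hξ | hξ) u hu
    · exact (hC ξ hξ u hu).trans (le_max_left _ _)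
    · exact (hD ξ hξ u hu).trans (le_max_right _ _)
  · intro ξ₀ _
    obtain ⟨L, N, hN, hL⟩ := hg.lipschitz ξ₀ R
    obtain ⟨C, hC⟩ := hg.bounded ξ₀ R
    refine ⟨N ∩ Metric.ball ξ₀ 1, nhdsWithin_le_nhds
      (Filter.inter_mem hN (Metric.ball_mem_nhds _ one_pos)), max L 0 + max C 0, by positivity,
      fun ξ hξ u hu => ?_⟩
    have h1 := hL ξ hξ.1 ξ₀ (mem_of_mem_nhds hN) u hu
    have h2 : ‖ξ - ξ₀‖ ≤ 1 := by rw [← dist_eq_norm]; exact (Metric.mem_ball.1 hξ.2).le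
    have h3 : L * ‖ξ - ξ₀‖ ≤ max L 0 * 1 := by gcongr; exact le_max_left _ _
    calc ‖g ξ u‖ = ‖(g ξ u - g ξ₀ u) + g ξ₀ u‖ := by rw [sub_add_cancel]
      _ ≤ _ := (norm_add_le _ _).trans (by linarith [hC u hu, le_max_left C 0])

/-- Compactness gives one constant for pairs closer than some δ; more distant pairs are covered by
the uniform bound, since 2C ≤ (2C/δ)|ξ - ξ'|. -/
theorem RegularField.exists_lipschitz_of_isCompact (hg : RegularField g) {K : Set X}
    (hK : IsCompact K) (R : ℝ) : ∃ L, 0 ≤ L ∧ ∀ ξ ∈ K, ∀ ξ' ∈ K, ∀ u, ‖u‖ ≤ R →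
      ‖g ξ u - g ξ' u‖ ≤ L * ‖ξ - ξ'‖ := by
  obtain ⟨C, hC0, hC⟩ := hg.exists_bound_of_isCompact hK R
  obtain ⟨L, δ, hL0, hδ, hL⟩ : ∃ L δ : ℝ, 0 ≤ L ∧ 0 < δ ∧ ∀ ξ ∈ K, ∀ ξ', ‖ξ - ξ'‖ < δ →
      ∀ u, ‖u‖ ≤ R → ‖g ξ u - g ξ' u‖ ≤ L * ‖ξ - ξ'‖ := by
    refine hK.induction_on (p := fun s => ∃ L δ : ℝ, 0 ≤ L ∧ 0 < δ ∧ ∀ ξ ∈ s, ∀ ξ',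
      ‖ξ - ξ'‖ < δ → ∀ u, ‖u‖ ≤ R → ‖g ξ u - g ξ' u‖ ≤ L * ‖ξ - ξ'‖)
      ⟨0, 1, le_rfl, one_pos, by simp⟩ ?_ ?_ ?_
    · rintro s t hst ⟨L, δ, h0, hδ, hL⟩
      exact ⟨L, δ, h0, hδ, fun ξ hξ => hL ξ (hst hξ)⟩
    · rintro s t ⟨L, δ, h0, hδ, hL⟩ ⟨L', δ', h0', hδ', hL'⟩
      refine ⟨max L L', min δ δ', h0.trans (le_max_left _ _), lt_min hδ hδ', ?_⟩
      rintro ξ (hξ | hξ) ξ' hd u hu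
      · refine (hL ξ hξ ξ' (hd.trans_le (min_le_left _ _)) u hu).trans ?_
        gcongr; exact le_max_left _ _
      · refine (hL' ξ hξ ξ' (hd.trans_le (min_le_right _ _)) u hu).trans ?_
        gcongr; exact le_max_right _ _
    · intro ξ₀ _
      obtain ⟨L, N, hN, hL⟩ := hg.lipschitz ξ₀ R
      obtain ⟨ε, hε, hεN⟩ := Metric.mem_nhds_iff.1 hN
      refine ⟨Metric.ball ξ₀ (ε / 2), nhdsWithin_le_nhds (Metric.ball_mem_nhds _ (half_pos hε)),
        max L 0, ε / 2, le_max_right _ _, half_pos hε, fun ξ hξ ξ' hd u hu => ?_⟩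
      have h1 : dist ξ ξ₀ < ε / 2 := hξ
      have h2 : dist ξ' ξ₀ < ε := by
        have := dist_triangle ξ' ξ ξ₀
        rw [dist_comm ξ' ξ, dist_eq_norm ξ ξ'] at this
        linarith
      refine (hL ξ (hεN (Metric.mem_ball.2 (by linarith))) ξ' (hεN h2) u hu).trans ?_
      gcongr; exact le_max_left _ _
  refine ⟨L + 2 * C / δ, by positivity, fun ξ hξ ξ' hξ' u hu => ?_⟩
  have hn := norm_nonneg (ξ - ξ')
  rcases lt_or_ge ‖ξ - ξ'‖ δ with hd | hd
  · refine (hL ξ hξ ξ' hd u hu).trans ?_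
    gcongr
    have : 0 ≤ 2 * C / δ := by positivity
    linarith
  · calc ‖g ξ u - g ξ' u‖ ≤ 2 * C := (norm_sub_le _ _).trans (by
          linarith [hC ξ hξ u hu, hC ξ' hξ' u hu])
      _ = 2 * C / δ * δ := by field_simp
      _ ≤ 2 * C / δ * ‖ξ - ξ'‖ := by gcongr
      _ ≤ _ := by nlinarith [mul_nonneg hL0 hn]

/-- Composition with a map which is locally Lipschitz in the quantitative sense below. -/
theorem RegularField.comp_lipschitzOn {Z : Type*} [NormedAddCommGroup Z] [MeasurableSpace Z]
    (hg : RegularField g) {h : Y → Z} (hm : Measurable h)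
    (hh : ∀ C, 0 ≤ C → ∃ L, 0 ≤ L ∧ ∀ v w, ‖v‖ ≤ C → ‖w‖ ≤ C → ‖h v - h w‖ ≤ L * ‖v - w‖) :
    RegularField (fun ξ u => h (g ξ u)) := by
  refine ⟨fun ξ => hm.comp (hg.measurable ξ), fun ξ R => ?_, fun ξ₀ R => ?_⟩
  · obtain ⟨C, hC⟩ := hg.bounded ξ R
    obtain ⟨L, hL0, hL⟩ := hh (max C 0) (le_max_right _ _)
    refine ⟨L * max C 0 + ‖h 0‖, fun u hu => ?_⟩
    have h1 : ‖g ξ u‖ ≤ max C 0 := (hC u hu).trans (le_max_left _ _)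
    have h2 := hL (g ξ u) 0 h1 (by simp)
    rw [sub_zero] at h2
    calc ‖h (g ξ u)‖ = ‖(h (g ξ u) - h 0) + h 0‖ := by rw [sub_add_cancel]
      _ ≤ L * ‖g ξ u‖ + ‖h 0‖ := (norm_add_le _ _).trans (by gcongr)
      _ ≤ _ := by gcongr
  · obtain ⟨L, N, hN, hL⟩ := hg.lipschitz ξ₀ R
    obtain ⟨C, hC⟩ := hg.bounded ξ₀ R
    set B := max L 0 + max C 0
    obtain ⟨L', hL0', hL'⟩ := hh B (by positivity)
    have hb : ∀ ξ ∈ N ∩ Metric.ball ξ₀ 1, ∀ u, ‖u‖ ≤ R → ‖g ξ u‖ ≤ B := by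
      intro ξ hξ u hu
      have h1 := hL ξ hξ.1 ξ₀ (mem_of_mem_nhds hN) u hu
      have h2 : ‖ξ - ξ₀‖ ≤ 1 := by rw [← dist_eq_norm]; exact (Metric.mem_ball.1 hξ.2).le
      have h3 : L * ‖ξ - ξ₀‖ ≤ max L 0 * 1 := by gcongr; exact le_max_left _ _
      calc ‖g ξ u‖ = ‖(g ξ u - g ξ₀ u) + g ξ₀ u‖ := by rw [sub_add_cancel]
        _ ≤ _ := (norm_add_le _ _).trans (by linarith [hC u hu, le_max_left C 0])
    refine ⟨L' * L, N ∩ Metric.ball ξ₀ 1, Filter.inter_mem hN (Metric.ball_mem_nhds _ one_pos),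
      fun ξ hξ ξ' hξ' u hu => ?_⟩
    refine (hL' _ _ (hb ξ hξ u hu) (hb ξ' hξ' u hu)).trans ?_
    rw [mul_assoc]
    gcongr
    exact hL ξ hξ.1 ξ' hξ'.1 u hu

theorem RegularField.continuous (hg : RegularField g) (u : U) :
    Continuous fun ξ => g ξ u := by
  refine continuous_iff_continuousAt.2 fun ξ₀ => ?_
  obtain ⟨L, N, hN, hL⟩ := hg.lipschitz ξ₀ ‖u‖
  rw [ContinuousAt, tendsto_iff_norm_sub_tendsto_zero]
  refine squeeze_zero' (Filter.Eventually.of_forall fun _ => norm_nonneg _)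
    (g := fun ξ => L * ‖ξ - ξ₀‖) ?_ ?_
  · filter_upwards [hN] with ξ hξ using hL ξ hξ ξ₀ (mem_of_mem_nhds hN) u le_rfl
  · have : Continuous fun ξ => L * ‖ξ - ξ₀‖ := by fun_prop
    simpa using this.tendsto ξ₀

/-- Measurability of the field along a continuous curve and a measurable input. -/
theorem RegularField.aestronglyMeasurable [BorelSpace Y] [SecondCountableTopology Y]
    [SecondCountableTopology X] [SecondCountableTopology U] [BorelSpace U]
    (hg : RegularField g) {v : ℝ → X} (hv : Continuous v) {u : ℝ → U} {μ : Measure ℝ}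
    (hu : AEStronglyMeasurable u μ) : AEStronglyMeasurable (fun s => g (v s) (u s)) μ := by
  let _ : MeasurableSpace X := borel X
  have : BorelSpace X := ⟨rfl⟩
  have h1 : Measurable (Function.uncurry g) :=
    measurable_uncurry_of_continuous_of_measurable (u := g) hg.continuous hg.measurable
  exact (h1.comp_aemeasurable (hv.aemeasurable.prodMk hu.aemeasurable)).aestronglyMeasurable

end Regularity

/-! ### The small-gain argument for the maximum of two level functions -/

section SmallGain

/-- The expansive level function associated with a gain. -/
noncomputable def levelFun (γ : ℝ → ℝ) (r : ℝ) : ℝ := r + γ r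

theorem ClassKInf.classKInf_levelFun {γ : ℝ → ℝ} (h : ClassKInf γ) : ClassKInf (levelFun γ) := h.id_add

/-- The summand r makes the level function expansive, so a decrease of its argument passes to it at
no less than the same rate, with no differentiability of γ. -/
theorem ClassKInf.sub_le_levelFun_sub {γ : ℝ → ℝ} (h : ClassKInf γ) {r s : ℝ} (hr : 0 ≤ r)
    (hrs : r ≤ s) : s - r ≤ levelFun γ s - levelFun γ r := by
  have := h.strictMono.monotoneOn hr (hr.trans hrs) hrs
  simp only [levelFun]
  linarith

/-- This identity makes the two branches of the maximum tie exactly on the graph of γ. -/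
theorem ClassKInf.levelFun_kInv {γ : ℝ → ℝ} (h : ClassKInf γ) {r : ℝ} (hr : 0 ≤ r) :
    levelFun (kInv γ) (γ r) = levelFun γ r := by
  simp only [levelFun, h.kInv_apply hr, add_comm]

/-- The gain condition at γ_s⁻¹(r) reads γ_f(r) < γ_s⁻¹(r); apply γ_s. -/
theorem SmallGain.swap {γf γs : ℝ → ℝ} (h : SmallGain γf γs) (hγf : ClassKInf γf)
    (hγs : ClassKInf γs) {r : ℝ} (hr : 0 < r) : γs (γf r) < r := by
  have h1 : 0 < kInv γs r := hγs.inv.toClassK.pos hr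
  have h2 := h _ h1
  rw [hγs.apply_kInv hr.le] at h2
  have h3 := hγs.strictMono (hγf.toClassK.nonneg hr.le) h1.le h2
  rwa [hγs.apply_kInv hr.le] at h3

variable {γf γs θs θf S F : ℝ → ℝ} {T A B : ℝ}

/-- The maximum of the two level functions has upper right Dini derivative at most the slower of
the two rates, above the level determined by the inputs. -/
theorem small_gain_dini (hγf : ClassKInf γf) (hγs : ClassKInf γs) (hgain : SmallGain γf γs)
    (hθs : ClassPD θs) (hθf : ClassPD θf) (hA : 0 ≤ A) (hB : 0 ≤ B)
    (hSc : ContinuousOn S (Icc 0 T)) (hFc : ContinuousOn F (Icc 0 T))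
    (hS0 : ∀ t, 0 ≤ S t) (hF0 : ∀ t, 0 ≤ F t)
    (hslow : ∀ a b c, 0 ≤ a → a ≤ b → b ≤ T →
      (∀ t ∈ Ioc a b, γs (F t) ≤ S t ∧ A ≤ S t ∧ c ≤ θs (S t)) → S b ≤ S a - c * (b - a))
    (hfast : ∀ a b c, 0 ≤ a → a ≤ b → b ≤ T →
      (∀ t ∈ Ioc a b, γf (S t) ≤ F t ∧ B ≤ F t ∧ c ≤ θf (F t)) → F b ≤ F a - c * (b - a))
    {t : ℝ} (ht : t ∈ Ico 0 T)
    (hlevel : max (levelFun γf A) (levelFun (kInv γf) B) <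
      max (levelFun γf (S t)) (levelFun (kInv γf) (F t)))
    {r : ℝ} (hr : -(min (θs (kInv (levelFun γf) (max (levelFun γf (S t))
        (levelFun (kInv γf) (F t)))))
      (θf (kInv (levelFun (kInv γf)) (max (levelFun γf (S t)) (levelFun (kInv γf) (F t)))))) < r) :
    ∃ᶠ s in 𝓝[>] t,
      slope (fun s => max (levelFun γf (S s)) (levelFun (kInv γf) (F s))) t s < r := by
  set P := levelFun γf with hPdef
  set Q := levelFun (kInv γf) with hQdef
  have hP : ClassKInf P := hγf.classKInf_levelFun
  have hQ : ClassKInf Q := hγf.inv.classKInf_levelFun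
  let W : ℝ → ℝ := fun s => max (P (S s)) (Q (F s))
  let a : ℝ → ℝ := fun l => min (θs (kInv P l)) (θf (kInv Q l))
  change max (P A) (Q B) < W t at hlevel
  change -(a (W t)) < r at hr
  have hWu0 : 0 ≤ max (P A) (Q B) := (hP.toClassK.nonneg hA).trans (le_max_left _ _)
  have hWt : 0 < W t := hWu0.trans_lt hlevel
  have hapos : 0 < a (W t) :=
    lt_min (hθs.pos _ (hP.inv.toClassK.pos hWt)) (hθf.pos _ (hQ.inv.toClassK.pos hWt))
  -- A rate strictly below a(W t) stays admissible near t by continuity; c > -r gives the slope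
  -- bound, and c > 0 makes both functions decrease.
  obtain ⟨c, hc1, hca⟩ := exists_between (max_lt (show -r < a (W t) by linarith) hapos)
  obtain ⟨hcr, hc0⟩ := max_lt_iff.1 hc1
  have hPSc : ContinuousOn (fun s => P (S s)) (Icc 0 T) :=
    hP.continuousOn.comp hSc fun s _ => hS0 s
  have hQFc : ContinuousOn (fun s => Q (F s)) (Icc 0 T) :=
    hQ.continuousOn.comp hFc fun s _ => hF0 s
  have hWc : ContinuousOn W (Icc 0 T) := hPSc.sup hQFc
  have hW0 : ∀ s, 0 ≤ W s := fun s => (hP.toClassK.nonneg (hS0 s)).trans (le_max_left _ _)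
  have hac : ContinuousOn a (Ici 0) :=
    (hθs.continuousOn.comp hP.inv.continuousOn hP.inv.toClassK.mapsTo).inf
      (hθf.continuousOn.comp hQ.inv.continuousOn hQ.inv.toClassK.mapsTo)
  have haWc : ContinuousOn (fun s => a (W s)) (Icc 0 T) := hac.comp hWc fun s _ => hW0 s
  have htI : t ∈ Icc 0 T := ⟨ht.1, ht.2.le⟩
  have hnear : ∀ᶠ s in 𝓝[Icc 0 T] t, c < a (W s) ∧ max (P A) (Q B) < W s :=
    ((haWc t htI).eventually_const_lt hca).and ((hWc t htI).eventually_const_lt hlevel)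
  -- a neighbourhood to the right can be described by an interval
  have hright : ∀ p : ℝ → Prop, (∀ᶠ s in 𝓝[Icc 0 T] t, p s) →
      ∃ b, t < b ∧ b ≤ T ∧ ∀ s ∈ Ico t b, p s := by
    intro p hp
    obtain ⟨δ, hδ, h⟩ := Metric.mem_nhdsWithin_iff.1 hp
    refine ⟨min T (t + δ), lt_min ht.2 (by linarith), min_le_left _ _, fun s hs => h ⟨?_, ?_⟩⟩
    · have := hs.2.trans_le (min_le_right _ _)
      rw [Metric.mem_ball, Real.dist_eq, abs_lt]
      constructor <;> linarith [hs.1]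
    · exact ⟨ht.1.trans hs.1, (hs.2.trans_le (min_le_left _ _)).le⟩
  -- The interval is half-open because r₀ will be the last time Q(F) lies below a descending line,
  -- and the strict dominance may fail at r₀ itself.
  have hfast' : ∀ r₀ s, t ≤ r₀ → r₀ ≤ s → s ≤ T →
      (∀ x ∈ Ioc r₀ s, P (S x) < Q (F x) ∧ c < a (W x) ∧ max (P A) (Q B) < W x) →
      Q (F s) ≤ Q (F r₀) - c * (s - r₀) := by
    intro r₀ s htr hrs hsT hx
    have hd := hfast r₀ s c (ht.1.trans htr) hrs hsT fun x hxm => by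
      obtain ⟨h1, h2, h3⟩ := hx x hxm
      have hWx : W x = Q (F x) := max_eq_right h1.le
      rw [hWx] at h2 h3
      refine ⟨?_, ?_, ?_⟩
      · by_contra! h
        have := hQ.strictMono (hF0 x) (hγf.toClassK.nonneg (hS0 x)) h
        rw [hQdef, hγf.levelFun_kInv (hS0 x)] at this
        exact lt_asymm h1 this
      · exact ((hQ.toClassK.lt_iff hB (hF0 x)).1 ((le_max_right _ _).trans_lt h3)).le
      · have h4 := h2.le.trans (min_le_right _ _)
        rwa [hQ.kInv_apply (hF0 x)] at h4
    have h5 : F s ≤ F r₀ := hd.trans (by nlinarith)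
    have h6 := hγf.inv.sub_le_levelFun_sub (hF0 s) h5
    linarith
  suffices h : ∃ b, t < b ∧ ∀ s ∈ Ioo t b, W s ≤ W t - c * (s - t) by
    obtain ⟨b, htb, hb⟩ := h
    apply Filter.Eventually.frequently
    filter_upwards [Ioo_mem_nhdsGT htb] with s hs
    have hst : 0 < s - t := sub_pos.2 hs.1
    rw [slope_def_field, div_lt_iff₀ hst]
    have := hb s hs
    change W s - W t < _
    nlinarith [mul_lt_mul_of_pos_right hcr hst]
  rcases le_or_gt (F t) (γf (S t)) with hcase | hcase
  · have hQP : Q (F t) ≤ P (S t) := by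
      have := hQ.strictMono.monotoneOn (hF0 t) (hγf.toClassK.nonneg (hS0 t)) hcase
      rwa [hQdef, hγf.levelFun_kInv (hS0 t)] at this
    have hWP : W t = P (S t) := max_eq_left hQP
    have hSpos : 0 < S t := by
      refine lt_of_le_of_ne (hS0 t) fun h => ?_
      rw [hWP, ← h, hP.zero] at hWt
      exact lt_irrefl _ hWt
    have hSA : A < S t := by
      rw [hWP] at hlevel
      exact (hP.toClassK.lt_iff hA (hS0 t)).1 ((le_max_left _ _).trans_lt hlevel)
    -- The small-gain condition enters here. The strict inequality persists to the right of t, so S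
    -- keeps decaying even if F overtakes γ_f(S).
    have hgs : γs (F t) < S t :=
      (hγs.strictMono.monotoneOn (hF0 t) (hγf.toClassK.nonneg (hS0 t)) hcase).trans_lt
        (hgain.swap hγf hγs hSpos)
    have hcθ : c < θs (S t) := by
      have := hca.trans_le (min_le_left _ _)
      rwa [hWP, hP.kInv_apply (hS0 t)] at this
    have hγsF : ContinuousOn (fun s => γs (F s)) (Icc 0 T) :=
      hγs.continuousOn.comp hFc fun s _ => hF0 s
    have hθS : ContinuousOn (fun s => θs (S s)) (Icc 0 T) :=
      hθs.continuousOn.comp hSc fun s _ => hS0 s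
    obtain ⟨b, htb, hbT, hb⟩ := hright _
      (hnear.and ((((hγsF t htI).eventually_lt (hSc t htI) hgs)).and
        (((hSc t htI).eventually_const_lt hSA).and ((hθS t htI).eventually_const_lt hcθ))))
    have hPs : ∀ s ∈ Ico t b, P (S s) ≤ W t - c * (s - t) := by
      intro s hs
      have h1 := hslow t s c ht.1 hs.1 (hs.2.le.trans hbT) fun x hx => by
        obtain ⟨_, h2, h3, h4⟩ := hb x ⟨hx.1.le, hx.2.trans_lt hs.2⟩
        exact ⟨h2.le, h3.le, h4.le⟩
      have h5 : S s ≤ S t := h1.trans (by nlinarith [hs.1])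
      have h6 := hγf.sub_le_levelFun_sub (hS0 s) h5
      rw [hWP]
      linarith
    refine ⟨b, htb, fun s hs => max_le (hPs s ⟨hs.1.le, hs.2⟩) ?_⟩
    by_contra! hcon
    have hsT : s ≤ T := hs.2.le.trans hbT
    have hsub : Icc t s ⊆ Icc 0 T := Icc_subset_Icc ht.1 hsT
    have hcl : IsClosed (Icc t s ∩ (fun x => Q (F x) + c * (x - t)) ⁻¹' Iic (W t)) :=
      ((hQFc.mono hsub).add (by fun_prop)).preimage_isClosed_of_isClosed isClosed_Icc isClosed_Iic
    -- After the last time r₀ at which Q(F) is below the line W t - c(x - t), Q(F) exceeds the line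
    -- and hence P(S). The fast decay then applies and keeps Q(F) below the line up to s, a
    -- contradiction.
    obtain ⟨r₀, hr₀, hmax⟩ := (isCompact_Icc.of_isClosed_subset hcl inter_subset_left).exists_isGreatest
      ⟨t, ⟨le_rfl, hs.1.le⟩, by simp [hWP, hQP]⟩
    have hr₀' : Q (F r₀) + c * (r₀ - t) ≤ W t := hr₀.2
    have := hfast' r₀ s hr₀.1.1 hr₀.1.2 hsT fun x hx => by
      have hxI : x ∈ Ico t b := ⟨hr₀.1.1.trans hx.1.le, hx.2.trans_lt hs.2⟩
      obtain ⟨⟨h2, h3⟩, _⟩ := hb x hxI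
      refine ⟨?_, h2, h3⟩
      by_contra! h
      have h4 := hPs x hxI
      have h5 : x ∈ Icc t s ∩ (fun x => Q (F x) + c * (x - t)) ⁻¹' Iic (W t) :=
        ⟨⟨hxI.1, hx.2⟩, show Q (F x) + c * (x - t) ≤ W t by linarith⟩
      exact absurd (hmax h5) (not_le.2 hx.1)
    linarith
  · have hPQ : P (S t) < Q (F t) := by
      have := hQ.strictMono (hγf.toClassK.nonneg (hS0 t)) (hF0 t) hcase
      rwa [hQdef, hγf.levelFun_kInv (hS0 t)] at this
    have hWQ : W t = Q (F t) := max_eq_right hPQ.le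
    obtain ⟨b, htb, hbT, hb⟩ := hright _
      (hnear.and ((hPSc t htI).eventually_lt (hQFc t htI) hPQ))
    refine ⟨b, htb, fun s hs => ?_⟩
    have h1 := hfast' t s le_rfl hs.1.le (hs.2.le.trans hbT) fun x hx => by
      obtain ⟨⟨h2, h3⟩, h4⟩ := hb x ⟨hx.1.le, hx.2.trans_lt hs.2⟩
      exact ⟨h4, h2, h3⟩
    have h2 := (hb s ⟨hs.1.le, hs.2⟩).2
    rw [hWQ]
    exact max_le (h2.le.trans h1) h1

end SmallGain

/-! ### Componentwise fields on the stacked Euclidean space -/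

section PairField

variable {n m p q : ℕ}

theorem norm_toLp_prod_le {k l : ℕ} (a : Euc k) (b : Euc l) :
    ‖(WithLp.toLp 2 (a, b) : EucProd k l)‖ ≤ ‖a‖ + ‖b‖ := by
  have h : (WithLp.toLp 2 (a, b) : EucProd k l) =
      WithLp.toLp 2 (a, (0 : Euc l)) + WithLp.toLp 2 ((0 : Euc k), b) := by
    rw [← WithLp.toLp_add]; simp
  rw [h]
  refine (norm_add_le _ _).trans ?_
  simp

/-- The field on the stacked state space with components `G₁`, `G₂`. -/
noncomputable def pairField (G₁ : Euc n × Euc m → Euc p → Euc n)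
    (G₂ : Euc n × Euc m → Euc q → Euc m) (ξ : EucProd n m) (u : EucProd p q) : EucProd n m :=
  WithLp.toLp 2 (G₁ (ξ.fst, ξ.snd) u.fst, G₂ (ξ.fst, ξ.snd) u.snd)

variable {G₁ : Euc n × Euc m → Euc p → Euc n} {G₂ : Euc n × Euc m → Euc q → Euc m}

/-- Regularity is formulated with the max norm on the product, solutions with the Euclidean norm on
stacked vectors; this inequality transfers the estimates. -/
theorem norm_fst_snd_sub_le (ξ ξ' : EucProd n m) :
    ‖((ξ.fst, ξ.snd) : Euc n × Euc m) - (ξ'.fst, ξ'.snd)‖ ≤ ‖ξ - ξ'‖ :=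
  max_le (WithLp.norm_fst_le _ (ξ - ξ')) (WithLp.norm_snd_le _ (ξ - ξ'))

theorem pairField_bound (h₁ : RegularField G₁) (h₂ : RegularField G₂) (e : EucProd n m)
    (R r : ℝ) : ∃ C, ∀ ξ, ‖ξ - e‖ ≤ R → ∀ u, ‖u‖ ≤ r → ‖pairField G₁ G₂ ξ u‖ ≤ C := by
  have hK := isCompact_closedBall ((e.fst, e.snd) : Euc n × Euc m) R
  obtain ⟨C₁, _, hC₁⟩ := h₁.exists_bound_of_isCompact hK r
  obtain ⟨C₂, _, hC₂⟩ := h₂.exists_bound_of_isCompact hK r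
  refine ⟨C₁ + C₂, fun ξ hξ u hu => (norm_toLp_prod_le _ _).trans ?_⟩
  have hmem : ((ξ.fst, ξ.snd) : Euc n × Euc m) ∈ Metric.closedBall (e.fst, e.snd) R :=
    mem_closedBall_iff_norm.2 ((norm_fst_snd_sub_le ξ e).trans hξ)
  exact add_le_add (hC₁ _ hmem _ ((WithLp.norm_fst_le _ _).trans hu))
    (hC₂ _ hmem _ ((WithLp.norm_snd_le _ _).trans hu))

theorem pairField_lipschitz (h₁ : RegularField G₁) (h₂ : RegularField G₂) (e : EucProd n m)
    (R r : ℝ) : ∃ L, ∀ ξ ξ', ‖ξ - e‖ ≤ R → ‖ξ' - e‖ ≤ R → ∀ u, ‖u‖ ≤ r →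
      ‖pairField G₁ G₂ ξ u - pairField G₁ G₂ ξ' u‖ ≤ L * ‖ξ - ξ'‖ := by
  have hK := isCompact_closedBall ((e.fst, e.snd) : Euc n × Euc m) R
  obtain ⟨L₁, hL₁0, hL₁⟩ := h₁.exists_lipschitz_of_isCompact hK r
  obtain ⟨L₂, hL₂0, hL₂⟩ := h₂.exists_lipschitz_of_isCompact hK r
  refine ⟨L₁ + L₂, fun ξ ξ' hξ hξ' u hu => ?_⟩
  have hmem : ∀ ξ : EucProd n m, ‖ξ - e‖ ≤ R →
      ((ξ.fst, ξ.snd) : Euc n × Euc m) ∈ Metric.closedBall (e.fst, e.snd) R := fun ξ hξ =>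
    mem_closedBall_iff_norm.2 ((norm_fst_snd_sub_le ξ e).trans hξ)
  rw [pairField, pairField, ← WithLp.toLp_sub, Prod.mk_sub_mk, add_mul]
  refine (norm_toLp_prod_le _ _).trans (add_le_add ?_ ?_)
  · refine (hL₁ _ (hmem ξ hξ) _ (hmem ξ' hξ') _ ((WithLp.norm_fst_le _ _).trans hu)).trans ?_
    gcongr
    exact norm_fst_snd_sub_le ξ ξ'
  · refine (hL₂ _ (hmem ξ hξ) _ (hmem ξ' hξ') _ ((WithLp.norm_snd_le _ _).trans hu)).trans ?_
    gcongr
    exact norm_fst_snd_sub_le ξ ξ'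

theorem continuous_fst_snd : Continuous fun ξ : EucProd n m => ((ξ.fst, ξ.snd) : Euc n × Euc m) :=
  WithLp.prod_continuous_ofLp 2 _ _

theorem pairField_exists_global_solution (h₁ : RegularField G₁) (h₂ : RegularField G₂)
    (e : EucProd n m) (u : ℝ → EucProd p q) (hu : IsInput u) (ξ₀ : EucProd n m)
    (hprior : ∀ T, ∃ M, ∀ ξ, ∀ t ∈ Icc 0 T, IsSolutionOn (pairField G₁ G₂) u ξ t → ξ 0 = ξ₀ →
      ‖ξ t - e‖ ≤ M) :
    ∃ ξ : ℝ → EucProd n m, ξ 0 = ξ₀ ∧ ∀ T, 0 ≤ T → IsSolutionOn (pairField G₁ G₂) u ξ T := by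
  refine exists_global_solution _ e u hu (fun v hv T => ?_) (pairField_bound h₁ h₂ e)
    (pairField_lipschitz h₁ h₂ e) ξ₀ hprior
  have hum := (hu T).1
  have hv' := continuous_fst_snd.comp hv
  have h3 := h₁.aestronglyMeasurable hv' ((WithLp.continuous_fst 2 _ _).comp_aestronglyMeasurable hum)
  have h4 := h₂.aestronglyMeasurable hv' ((WithLp.continuous_snd 2 _ _).comp_aestronglyMeasurable hum)
  exact (WithLp.prod_continuous_toLp 2 _ _).comp_aestronglyMeasurable (h3.prodMk h4)

/-- Decrease of a continuously differentiable function along a solution. -/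
theorem pairField_decrease (h₁ : RegularField G₁) (h₂ : RegularField G₂)
    {u : ℝ → EucProd p q} (hu : IsInput u) {ξ : ℝ → EucProd n m} {T : ℝ}
    (hξ : IsSolutionOn (pairField G₁ G₂) u ξ T) {V : EucProd n m → ℝ} (hV : ContDiff ℝ 1 V)
    {a b c : ℝ} (ha : 0 ≤ a) (hab : a ≤ b) (hbT : b ≤ T)
    (hdec : ∀ t ∈ Ioc a b, ∀ v, ‖v‖ ≤ inputSup u T →
      fderiv ℝ V (ξ t) (pairField G₁ G₂ (ξ t) v) ≤ -c) :
    V (ξ b) ≤ V (ξ a) - c * (b - a) := by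
  have hsub : Icc a b ⊆ Icc 0 T := Icc_subset_Icc ha hbT
  obtain ⟨R, hR⟩ := isCompact_Icc.exists_bound_of_continuousOn hξ.1
  obtain ⟨C, hC⟩ := pairField_bound h₁ h₂ 0 R (inputSup u T)
  have hII : ∀ t ∈ Icc 0 T, IntervalIntegrable (fun s => pairField G₁ G₂ (ξ s) (u s)) volume 0 t :=
    fun t ht => (hξ.2 t ht).1
  have hae := ae_restrict_of_ae_restrict_of_subset hsub (hu.ae_norm_le T)
  refine decrease_along_curve (f := fun s => pairField G₁ G₂ (ξ s) (u s)) (M := C) hV hab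
    (hξ.1.mono hsub)
    ((hII a ⟨ha, hab.trans hbT⟩).symm.trans (hII b ⟨ha.trans hab, hbT⟩)) ?_ ?_ ?_
  · intro s hs t ht
    rw [(hξ.2 t (hsub ht)).2, (hξ.2 s (hsub hs)).2, add_sub_add_left_eq_sub,
      intervalIntegral.integral_interval_sub_left (hII t (hsub ht)) (hII s (hsub hs))]
  · filter_upwards [hae, ae_restrict_mem measurableSet_Icc] with r hr hrI
    exact hC _ (by simpa using hR r (hsub hrI)) _ hr
  -- The left endpoint is a null set, so the decay condition is needed only on the half-open
  -- interval.
  · rw [← restrict_Ioc_eq_restrict_Icc] at hae ⊢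
    filter_upwards [hae, ae_restrict_mem measurableSet_Ioc] with r hr hrI
    exact hdec r hrI _ hr

end PairField

/-! ### Speed factors that preserve regularity -/

section SpeedScaling

/-- The speed `κ(s) / (1 + s)`, extended evenly in the denominator. -/
noncomputable def scaledSpeed (κ : ℝ → ℝ) (s : ℝ) : ℝ := κ s / (1 + |s|)

variable {κ : ℝ → ℝ}

theorem scaledSpeed_mul_le (h0 : ∀ s, 0 ≤ κ s) {s : ℝ} (hs : 0 ≤ s) :
    scaledSpeed κ s * s ≤ κ s := by
  rw [scaledSpeed, abs_of_nonneg hs, div_mul_eq_mul_div, div_le_iff₀ (by positivity)]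
  nlinarith [h0 s]

theorem classP_scaledSpeed (hκ : ClassP κ) : ClassP (scaledSpeed κ) := by
  refine ⟨?_, fun r hr => ?_, ?_⟩
  · exact hκ.continuousOn.div (by fun_prop) fun s _ => by positivity
  · have := hκ.pos r hr
    rw [scaledSpeed]; positivity
  · have := hκ.zero
    rw [scaledSpeed]; positivity

/-- The new field is g followed by v ↦ ρ(|v|)v, which is Lipschitz on balls because κ is Lipschitz.
Making the speed a function of |g| alone is what reduces regularity to a statement about this one
map. -/
theorem regularField_scaledSpeed {X U : Type*} [NormedAddCommGroup X]
    [NormedAddCommGroup U] [MeasurableSpace U] {k : ℕ} {g : X → U → Euc k} (hg : RegularField g)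
    (hL : LipschitzWith 1 κ) (h0 : ∀ s, 0 ≤ κ s) :
    RegularField (fun ξ u => scaledSpeed κ ‖g ξ u‖ • g ξ u) := by
  refine hg.comp_lipschitzOn (h := fun v => scaledSpeed κ ‖v‖ • v) ?_ fun C hC => ?_
  · have hc : Continuous κ := hL.continuous
    have : Continuous fun v : Euc k => scaledSpeed κ ‖v‖ • v := by
      simp only [scaledSpeed]
      refine ((hc.comp continuous_norm).div (by fun_prop) fun v => ?_).smul continuous_id
      positivity
    exact this.measurable
  · set B := κ 0 + C with hB
    have hB0 : 0 ≤ B := add_nonneg (h0 0) hC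
    refine ⟨(1 + B) * C + B, by positivity, fun v w hv hw => ?_⟩
    have hκL : ∀ s t, |κ s - κ t| ≤ |s - t| := fun s t => by
      simpa [Real.dist_eq] using hL.dist_le_mul s t
    have hκB : κ ‖w‖ ≤ B := by
      have := (le_abs_self _).trans (hκL ‖w‖ 0)
      rw [sub_zero, abs_of_nonneg (norm_nonneg w)] at this
      linarith
    have hvw : |‖v‖ - ‖w‖| ≤ ‖v - w‖ := abs_norm_sub_norm_le v w
    have hv1 : 0 < 1 + ‖v‖ := by positivity
    have hw1 : 0 < 1 + ‖w‖ := by positivity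
    have hsv : ∀ v : Euc k, scaledSpeed κ ‖v‖ = κ ‖v‖ / (1 + ‖v‖) := fun v => by
      rw [scaledSpeed, abs_of_nonneg (norm_nonneg v)]
    have hfr : ∀ {y x : ℝ}, 0 ≤ y → 0 ≤ x → y / (1 + x) ≤ y := fun {y x} hy hx => by
      rw [div_le_iff₀ (by positivity)]; nlinarith
    have hw2 : scaledSpeed κ ‖w‖ ≤ B := by
      rw [hsv]; exact (hfr (h0 _) (norm_nonneg _)).trans hκB
    have hw0 : 0 ≤ scaledSpeed κ ‖w‖ := by
      rw [hsv]; exact div_nonneg (h0 _) hw1.le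
    have hdiff : |scaledSpeed κ ‖v‖ - scaledSpeed κ ‖w‖| ≤ (1 + B) * ‖v - w‖ := by
      have heq : scaledSpeed κ ‖v‖ - scaledSpeed κ ‖w‖ =
          (κ ‖v‖ - κ ‖w‖) / (1 + ‖v‖) + scaledSpeed κ ‖w‖ * ((‖w‖ - ‖v‖) / (1 + ‖v‖)) := by
        rw [hsv, hsv]; field_simp; ring
      rw [heq]
      refine (abs_add_le _ _).trans ?_
      rw [abs_mul, abs_div, abs_div, abs_of_pos hv1, abs_of_nonneg hw0, abs_sub_comm ‖w‖]
      have h1 : |κ ‖v‖ - κ ‖w‖| / (1 + ‖v‖) ≤ ‖v - w‖ :=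
        (hfr (abs_nonneg _) (norm_nonneg _)).trans ((hκL _ _).trans hvw)
      have h2 : scaledSpeed κ ‖w‖ * (|‖v‖ - ‖w‖| / (1 + ‖v‖)) ≤ B * ‖v - w‖ :=
        mul_le_mul hw2 ((hfr (abs_nonneg _) (norm_nonneg _)).trans hvw) (by positivity) hB0
      linarith
    calc ‖scaledSpeed κ ‖v‖ • v - scaledSpeed κ ‖w‖ • w‖
        = ‖(scaledSpeed κ ‖v‖ - scaledSpeed κ ‖w‖) • v + scaledSpeed κ ‖w‖ • (v - w)‖ := by
          congr 1; rw [sub_smul, smul_sub]; abel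
      _ ≤ |scaledSpeed κ ‖v‖ - scaledSpeed κ ‖w‖| * ‖v‖ + scaledSpeed κ ‖w‖ * ‖v - w‖ := by
          refine (norm_add_le _ _).trans ?_
          rw [norm_smul, norm_smul, Real.norm_eq_abs, Real.norm_of_nonneg hw0]
      _ ≤ (1 + B) * ‖v - w‖ * C + B * ‖v - w‖ := by gcongr
      _ = _ := by ring

end SpeedScaling

theorem ClassKInf.exists_pos_forall_le {a : ℝ → ℝ} (h : ClassKInf a) {ε : ℝ} (hε : 0 < ε) :
    ∃ δ, 0 < δ ∧ ∀ r, 0 ≤ r → r ≤ δ → a r ≤ ε := by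
  refine ⟨kInv a ε, h.inv.toClassK.pos hε, fun r hr hrδ => ?_⟩
  rw [← h.apply_kInv hε.le]
  exact h.strictMono.monotoneOn hr (h.inv.toClassK.nonneg hε.le) hrδ

theorem ClassKL.le_at_zero {b : ℝ → ℝ → ℝ} (h : ClassKL b) {s t : ℝ} (hs : 0 ≤ s) (ht : 0 ≤ t) :
    b s t ≤ b s 0 := by
  rcases hs.eq_or_lt with rfl | hs
  · rw [(h.classK t ht).zero, (h.classK 0 le_rfl).zero]
  · exact (h.decreasing s hs).antitoneOn self_mem_Ici ht ht

/-! ### Partial derivatives -/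

section PartialDerivatives

variable {E F : Type*} [NormedAddCommGroup E] [NormedSpace ℝ E] [NormedAddCommGroup F]
  [NormedSpace ℝ F]

theorem fderiv_comp_continuousLinearMap {V : F → ℝ} (hV : ContDiff ℝ 1 V) (L : E →L[ℝ] F)
    (x h : E) : fderiv ℝ (fun y => V (L y)) x h = fderiv ℝ V (L x) (L h) := by
  have h1 : HasFDerivAt (fun y => V (L y)) ((fderiv ℝ V (L x)).comp L) x :=
    HasFDerivAt.comp (g := V) x (hV.differentiable one_ne_zero (L x)).hasFDerivAt L.hasFDerivAt
  rw [h1.fderiv]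
  rfl

theorem fderiv_uncurried_apply {V : E → F → ℝ}
    (hV : ContDiff ℝ 1 (fun v : E × F => V v.1 v.2)) (x h : E) (y k : F) :
    fderiv ℝ (fun v : E × F => V v.1 v.2) (x, y) (h, k) =
      fderiv ℝ (fun x => V x y) x h + fderiv ℝ (fun y => V x y) y k := by
  have h1 := (hV.differentiable one_ne_zero (x, y)).hasFDerivAt
  set D := fderiv ℝ (fun v : E × F => V v.1 v.2) (x, y)
  have hx : HasFDerivAt (fun x => V x y) (D.comp (.inl ℝ E F)) x :=
    HasFDerivAt.comp (g := fun v : E × F => V v.1 v.2) x h1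
      (hasFDerivAt_prodMk_left (𝕜 := ℝ) x y)
  have hy : HasFDerivAt (fun y => V x y) (D.comp (.inr ℝ E F)) y :=
    HasFDerivAt.comp (g := fun v : E × F => V v.1 v.2) y h1
      (hasFDerivAt_prodMk_right (𝕜 := ℝ) x y)
  rw [hx.fderiv, hy.fderiv]
  change D (h, k) = D (h, 0) + D (0, k)
  rw [← map_add]
  simp

end PartialDerivatives

/-! ### Lyapunov functions, the speed profile and the composite function -/

section Composite

variable {n m p q : ℕ} {gs : Euc n → Euc m → Euc p → Euc n} {gf : Euc m → Euc n → Euc q → Euc m}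
  {φ : Euc n → Euc m} {Vs : Euc n → ℝ} {Vf : Euc m → Euc n → ℝ}
  {asLow asUp γs χs αs afLow afUp χf αf lf1 lf2 γf ρsUp ρ0 ρsLow : ℝ → ℝ}

theorem SlowLyapunov.norm_le (hs : SlowLyapunov gs Vs Vf asLow asUp γs χs αs) (x : Euc n) :
    ‖x‖ ≤ kInv asLow (Vs x) :=
  hs.classKInf_aLow.le_kInv (norm_nonneg _) (hs.nonneg x) (hs.lower x)

theorem FastLyapunov.norm_sub_le (hf : FastLyapunov gf φ Vs Vf afLow afUp χf αf lf1 lf2)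
    (z : Euc m) (x : Euc n) : ‖z - φ x‖ ≤ kInv afLow (Vf z x) :=
  hf.classKInf_aLow.le_kInv (norm_nonneg _) (hf.nonneg z x) (hf.lower z x)

theorem SlowLyapunov.apply_zero (hs : SlowLyapunov gs Vs Vf asLow asUp γs χs αs) : Vs 0 = 0 := by
  refine le_antisymm ?_ (hs.nonneg 0)
  simpa [hs.classKInf_aUp.zero] using hs.upper 0

theorem FastLyapunov.apply_steady (hf : FastLyapunov gf φ Vs Vf afLow afUp χf αf lf1 lf2)
    (x : Euc n) : Vf (φ x) x = 0 := by
  refine le_antisymm ?_ (hf.nonneg _ x)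
  simpa [hf.classKInf_aUp.zero] using hf.upper (φ x) x

/-- Small values of the Lyapunov functions force the state to be near the equilibrium. -/
theorem state_small_of_lyapunov_small (hs : SlowLyapunov gs Vs Vf asLow asUp γs χs αs)
    (hf : FastLyapunov gf φ Vs Vf afLow afUp χf αf lf1 lf2) (hφ : Continuous φ)
    {ε : ℝ} (hε : 0 < ε) :
    ∃ δ, 0 < δ ∧ ∀ x z, Vs x ≤ δ → Vf z x ≤ δ → ‖x‖ < ε ∧ ‖z - φ 0‖ < ε := by
  obtain ⟨η, hη, hφη⟩ := Metric.continuousAt_iff.1 (hφ.continuousAt (x := 0)) (ε / 2) (half_pos hε)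
  obtain ⟨δ₁, hδ₁, h₁⟩ := hs.classKInf_aLow.inv.exists_pos_forall_le
    (half_pos (lt_min hε hη))
  obtain ⟨δ₂, hδ₂, h₂⟩ := hf.classKInf_aLow.inv.exists_pos_forall_le
    (show 0 < ε / 4 by linarith)
  refine ⟨min δ₁ δ₂, lt_min hδ₁ hδ₂, fun x z hx hz => ?_⟩
  have hx1 : ‖x‖ < min ε η :=
    ((hs.norm_le x).trans (h₁ _ (hs.nonneg x) (hx.trans (min_le_left _ _)))).trans_lt
      (half_lt_self (lt_min hε hη))
  refine ⟨hx1.trans_le (min_le_left _ _), ?_⟩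
  have h3 : ‖z - φ x‖ ≤ ε / 4 :=
    (hf.norm_sub_le z x).trans (h₂ _ (hf.nonneg z x) (hz.trans (min_le_right _ _)))
  have h4 : ‖φ x - φ 0‖ < ε / 2 := by
    rw [← dist_eq_norm]
    exact hφη (by rw [dist_zero_right]; exact hx1.trans_le (min_le_right _ _))
  have h5 : ‖z - φ 0‖ ≤ ‖z - φ x‖ + ‖φ x - φ 0‖ := by
    simpa using norm_add_le (z - φ x) (φ x - φ 0)
  linarith

/-- Bounds on the Lyapunov functions bound the state. -/
theorem state_bounded_of_lyapunov_bounded (hs : SlowLyapunov gs Vs Vf asLow asUp γs χs αs)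
    (hf : FastLyapunov gf φ Vs Vf afLow afUp χf αf lf1 lf2) (hφ : Continuous φ) (R : ℝ) :
    ∃ M, ∀ x z, Vs x ≤ R → Vf z x ≤ R → ‖x‖ ≤ M ∧ ‖z - φ 0‖ ≤ M := by
  set r := kInv asLow (max R 0)
  obtain ⟨B, hB⟩ := (isCompact_closedBall (0 : Euc n) r).exists_bound_of_continuousOn
    (f := fun x => φ x - φ 0) (by fun_prop)
  refine ⟨max r (kInv afLow (max R 0) + B), fun x z hx hz => ?_⟩
  have h1 : ‖x‖ ≤ r := (hs.norm_le x).trans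
    (hs.classKInf_aLow.inv.strictMono.monotoneOn (hs.nonneg x) (mem_Ici.2 (le_max_right _ _))
      (hx.trans (le_max_left _ _)))
  have h2 : ‖z - φ x‖ ≤ kInv afLow (max R 0) := (hf.norm_sub_le z x).trans
    (hf.classKInf_aLow.inv.strictMono.monotoneOn (hf.nonneg z x) (mem_Ici.2 (le_max_right _ _))
      (hz.trans (le_max_left _ _)))
  have h3 := hB x (by simpa using h1)
  have h4 : ‖z - φ 0‖ ≤ ‖z - φ x‖ + ‖φ x - φ 0‖ := by
    simpa using norm_add_le (z - φ x) (φ x - φ 0)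
  exact ⟨h1.trans (le_max_left _ _), le_trans (by linarith) (le_max_right _ _)⟩

/-- The existence of a speed profile compatible with the bound required where the boundary layer
dominates. -/
theorem exists_speed_profile (hφ : Continuous φ) (hφ0 : gs 0 (φ 0) 0 = 0)
    (hcont : ContinuousAt (fun v : Euc n × Euc m × Euc p => gs v.1 v.2.1 v.2.2) (0, φ 0, 0))
    (hs : SlowLyapunov gs Vs Vf asLow asUp γs χs αs)
    (hf : FastLyapunov gf φ Vs Vf afLow afUp χf αf lf1 lf2) (hγf : ClassKInf γf)
    (hρ : ClassP ρsUp) (hmono : MonotoneOn ρsUp (Ici 0)) :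
    ∃ κ, LipschitzWith 1 κ ∧ ClassP κ ∧ (∀ s, 0 ≤ κ s) ∧ ∀ x z d, γf (Vs x) ≤ Vf z x →
      γf (χs ‖d‖) ≤ Vf z x → κ ‖gs x z d‖ ≤ ρsUp (Vf z x) := by
  -- The infimal convolution runs over the region where V_f dominates; the fast input w plays no
  -- role in the bound on |g_s|.
  let α := {v : Euc n × Euc m × Euc p // γf (Vs v.1) ≤ Vf v.2.1 v.1 ∧
    γf (χs ‖v.2.2‖) ≤ Vf v.2.1 v.1}
  have : Nonempty α := ⟨(0, φ 0, 0), by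
    simp [hs.apply_zero, hf.apply_steady, hγf.zero, hs.classKInf_χs.zero]⟩
  suffices hloc : ∀ r, 0 < r → ∃ δ, 0 < δ ∧ ∀ v : α, |r - ‖gs v.1.1 v.1.2.1 v.1.2.2‖| ≤ δ →
      δ ≤ ρsUp (Vf v.1.2.1 v.1.1) by
    obtain ⟨κ, h1, h2, h3, h4⟩ := exists_lipschitz_classP_le (α := α)
      (fun v => ‖gs v.1.1 v.1.2.1 v.1.2.2‖) (fun v => ρsUp (Vf v.1.2.1 v.1.1))
      (fun v => hρ.nonneg (hf.nonneg _ _)) hloc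
    exact ⟨κ, h1, h2, h3, fun x z d hx hd => h4 ⟨(x, z, d), hx, hd⟩⟩
  intro r hr
  obtain ⟨ε, hε, hgs⟩ := Metric.continuousAt_iff.1 hcont (r / 2) (half_pos hr)
  obtain ⟨δ₁, hδ₁, hst⟩ := state_small_of_lyapunov_small hs hf hφ hε
  obtain ⟨δ₂, hδ₂, hs2⟩ := hγf.inv.exists_pos_forall_le hδ₁
  obtain ⟨δ₃, hδ₃, hs3⟩ :=
    hs.classKInf_χs.inv.exists_pos_forall_le (show 0 < ε / 2 by linarith)
  obtain ⟨δ₄, hδ₄, hs4⟩ := hγf.inv.exists_pos_forall_le hδ₃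
  set δ := min δ₁ (min δ₂ δ₄)
  have hδ : 0 < δ := lt_min hδ₁ (lt_min hδ₂ hδ₄)
  -- If V_f ≥ δ, monotonicity of ρ̄_s gives the bound. If V_f < δ, the point is close enough to the
  -- equilibrium that |g_s| < r/2, which is incompatible with |r - |g_s|| ≤ r/4.
  refine ⟨min (r / 4) (ρsUp δ), lt_min (by linarith) (hρ.pos δ hδ), ?_⟩
  rintro ⟨⟨x, z, d⟩, hx, hd⟩ hrf
  simp only at hx hd hrf ⊢
  have hv0 := hf.nonneg z x
  rcases le_or_gt δ (Vf z x) with hv | hv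
  · exact (min_le_right _ _).trans (hmono hδ.le hv0 hv)
  · exfalso
    have hVs : Vs x ≤ δ₁ := (hγf.le_kInv (hs.nonneg x) hv0 hx).trans
      (hs2 _ hv0 (hv.le.trans ((min_le_right _ _).trans (min_le_left _ _))))
    obtain ⟨hxε, hzε⟩ := hst x z hVs (hv.le.trans (min_le_left _ _))
    have hχd : χs ‖d‖ ≤ δ₃ := (hγf.le_kInv (hs.classKInf_χs.toClassK.nonneg (norm_nonneg _)) hv0
      hd).trans (hs4 _ hv0 (hv.le.trans ((min_le_right _ _).trans (min_le_right _ _))))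
    have hdε : ‖d‖ ≤ ε / 2 := (hs.classKInf_χs.le_kInv (norm_nonneg _)
      (hs.classKInf_χs.toClassK.nonneg (norm_nonneg _)) le_rfl).trans
        (hs3 _ (hs.classKInf_χs.toClassK.nonneg (norm_nonneg _)) hχd)
    have := @hgs (x, z, d) (by
      rw [Prod.dist_eq, Prod.dist_eq]
      refine max_lt ?_ (max_lt ?_ ?_)
      · simpa using hxε
      · rw [dist_eq_norm]; exact hzε
      · simp only [dist_zero_right]; linarith)
    simp only [hφ0, dist_zero_right] at this
    have h5 := (le_abs_self _).trans (hrf.trans (min_le_left _ _))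
    linarith

/-- The speed is bounded below where the reduced-order subsystem dissipates. -/
theorem exists_slowSpeedLowerBound
    (hreg : RegularField (fun (ξ : Euc n × Euc m) (d : Euc p) => gs ξ.1 ξ.2 d))
    (hφ : Continuous φ) (hs : SlowLyapunov gs Vs Vf asLow asUp γs χs αs)
    (hf : FastLyapunov gf φ Vs Vf afLow afUp χf αf lf1 lf2) (hρ0 : ClassP ρ0) :
    ∃ ρsLow, ClassP ρsLow ∧
      SlowSpeedLowerBound Vs Vf γs χs (fun x z d => ρ0 ‖gs x z d‖) ρsLow := by
  let α := {v : Euc n × Euc m × Euc p // max (γs (Vf v.2.1 v.1)) (χs ‖v.2.2‖) ≤ Vs v.1}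
  have : Nonempty α := ⟨(0, φ 0, 0), by
    simp [hs.apply_zero, hf.apply_steady, hs.classKInf_γs.zero, hs.classKInf_χs.zero]⟩
  suffices hloc : ∀ r, 0 < r → ∃ δ, 0 < δ ∧ ∀ v : α, |r - Vs v.1.1| ≤ δ →
      δ ≤ ρ0 ‖gs v.1.1 v.1.2.1 v.1.2.2‖ by
    obtain ⟨κ, _, h2, _, h4⟩ := exists_lipschitz_classP_le (α := α)
      (fun v => Vs v.1.1) (fun v => ρ0 ‖gs v.1.1 v.1.2.1 v.1.2.2‖)
      (fun v => hρ0.nonneg (norm_nonneg _)) hloc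
    exact ⟨κ, h2, fun x z d hx => h4 ⟨(x, z, d), hx⟩⟩
  intro r hr
  have hγ := hs.classKInf_γs
  have hχ := hs.classKInf_χs
  have hr2 : 0 ≤ 3 * r / 2 := by positivity
  obtain ⟨M, hM⟩ := state_bounded_of_lyapunov_bounded hs hf hφ
    (max (3 * r / 2) (kInv γs (3 * r / 2)))
  obtain ⟨C, _, hC⟩ := hreg.exists_bound_of_isCompact
    (isCompact_closedBall ((0, φ 0) : Euc n × Euc m) M) (kInv χs (3 * r / 2))
  obtain ⟨K, hK⟩ := (isCompact_closedBall (0 : Euc n) M).exists_bound_of_continuousOn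
    (hs.contDiff.continuous_fderiv one_ne_zero).continuousOn
  obtain ⟨s₀, hs₀, hmin⟩ := (isCompact_Icc (a := r / 2) (b := 3 * r / 2)).exists_isMinOn
    ⟨r, by constructor <;> linarith⟩
    (hs.classPD_αs.continuousOn.mono fun s hs => mem_Ici.2 (by linarith [hs.1]))
  have hαpos : 0 < αs s₀ := hs.classPD_αs.pos _ (by linarith [hs₀.1])
  -- Lower bound for |g_s| on the shell r/2 ≤ V_s ≤ 3r/2: the least dissipation there divided by a
  -- bound on the gradient of V_s, with 1 added to keep the denominator positive.
  set c := αs s₀ / (max K 0 + 1) with hc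
  have hcpos : 0 < c := by positivity
  -- a positive lower bound of `ρ0` on the relevant range
  obtain ⟨μ, hμ, hμle⟩ : ∃ μ, 0 < μ ∧ ∀ s ∈ Icc c C, μ ≤ ρ0 s := by
    rcases (Icc c C).eq_empty_or_nonempty with h | h
    · exact ⟨1, one_pos, by simp [h]⟩
    · obtain ⟨s₁, hs₁, hmin₁⟩ := isCompact_Icc.exists_isMinOn h
        (hρ0.continuousOn.mono fun s hs => mem_Ici.2 (hcpos.le.trans hs.1))
      exact ⟨ρ0 s₁, hρ0.pos _ (hcpos.trans_le hs₁.1), fun s hs => hmin₁ hs⟩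
  refine ⟨min (r / 2) μ, lt_min (half_pos hr) hμ, ?_⟩
  rintro ⟨⟨x, z, d⟩, hx⟩ hrf
  simp only at hx hrf ⊢
  obtain ⟨h5, h6⟩ := abs_le.1 (hrf.trans (min_le_left _ _))
  have hVs : Vs x ≤ 3 * r / 2 := by linarith
  have hVf : Vf z x ≤ kInv γs (3 * r / 2) :=
    hγ.le_kInv (hf.nonneg z x) hr2 ((le_max_left _ _).trans (hx.trans hVs))
  have hd : ‖d‖ ≤ kInv χs (3 * r / 2) :=
    hχ.le_kInv (norm_nonneg _) hr2 ((le_max_right _ _).trans (hx.trans hVs))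
  obtain ⟨hxM, hzM⟩ := hM x z (hVs.trans (le_max_left _ _)) (hVf.trans (le_max_right _ _))
  have hgC : ‖gs x z d‖ ≤ C := hC (x, z) (by
    rw [mem_closedBall_iff_norm, Prod.mk_sub_mk, sub_zero]
    exact max_le hxM hzM) d hd
  have hDK : ‖fderiv ℝ Vs x‖ ≤ K := hK x (by simpa using hxM)
  have hdec := hs.decay x z d hx
  have hα : αs s₀ ≤ αs (Vs x) := hmin ⟨by linarith, hVs⟩
  have h7 : αs s₀ ≤ ‖gs x z d‖ * (max K 0 + 1) := by
    have h8 := (neg_abs_le _).trans' (neg_le_neg ((fderiv ℝ Vs x).le_opNorm (gs x z d)))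
    have h9 : ‖fderiv ℝ Vs x‖ * ‖gs x z d‖ ≤ (max K 0 + 1) * ‖gs x z d‖ := by
      gcongr; linarith [le_max_left K 0]
    linarith
  exact (min_le_right _ _).trans (hμle _ ⟨by rw [hc, div_le_iff₀ (by positivity)]; exact h7, hgC⟩)

/-- The composite Lyapunov function is comparable to the distance to the equilibrium. -/
theorem exists_classKInf_composite_bounds (hφ : Continuous φ)
    (hs : SlowLyapunov gs Vs Vf asLow asUp γs χs αs)
    (hf : FastLyapunov gf φ Vs Vf afLow afUp χf αf lf1 lf2) (hγf : ClassKInf γf)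
    {W : EucProd n m → ℝ}
    (hW : W = fun ξ => max (levelFun γf (Vs ξ.fst)) (levelFun (kInv γf) (Vf ξ.snd ξ.fst))) :
    (∃ κ, ClassKInf κ ∧ ∀ ξ, κ ‖ξ - WithLp.toLp 2 (0, φ 0)‖ ≤ W ξ) ∧
      ∃ κ, ClassKInf κ ∧ ∀ ξ, κ (W ξ) ≤ ‖ξ - WithLp.toLp 2 (0, φ 0)‖ := by
  set e : EucProd n m := WithLp.toLp 2 (0, φ 0) with he
  have hP := hγf.classKInf_levelFun
  have hQ := hγf.inv.classKInf_levelFun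
  have hVs : ∀ ξ, Vs ξ.fst ≤ W ξ := fun ξ => by
    rw [hW]
    refine le_trans ?_ (le_max_left _ _)
    rw [levelFun]
    linarith [hγf.toClassK.nonneg (hs.nonneg ξ.fst)]
  have hVf : ∀ ξ, Vf ξ.snd ξ.fst ≤ W ξ := fun ξ => by
    rw [hW]
    refine le_trans ?_ (le_max_right _ _)
    rw [levelFun]
    linarith [hγf.inv.toClassK.nonneg (hf.nonneg ξ.snd ξ.fst)]
  have hW0 : ∀ ξ, 0 ≤ W ξ := fun ξ => (hs.nonneg _).trans (hVs ξ)
  have hnorm : ∀ ξ : EucProd n m, ‖ξ - e‖ ≤ ‖ξ.fst‖ + ‖ξ.snd - φ 0‖ := fun ξ => by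
    have := norm_toLp_prod_le ξ.fst (ξ.snd - φ 0)
    convert this using 2
    refine WithLp.ofLp_injective 2 (Prod.ext ?_ rfl)
    exact sub_zero ξ.fst
  have hWc : Continuous W := by
    have hfst : Continuous fun ξ : EucProd n m => ξ.fst := WithLp.continuous_fst 2 _ _
    have hsnd : Continuous fun ξ : EucProd n m => ξ.snd := WithLp.continuous_snd 2 _ _
    have h1 := hs.contDiff.continuous.comp hfst
    have h2 : Continuous fun ξ : EucProd n m => Vf ξ.snd ξ.fst :=
      hf.contDiff.continuous.comp (hsnd.prodMk hfst)
    rw [hW]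
    exact (hP.continuousOn.comp_continuous h1 fun ξ => hs.nonneg _).max
      (hQ.continuousOn.comp_continuous h2 fun ξ => hf.nonneg _ _)
  have hWe : W e = 0 := by
    simp [hW, he, hs.apply_zero, hf.apply_steady, hP.zero, hQ.zero]
  -- Both comparisons use only that each quantity is bounded where the other is and small where the
  -- other is, so no explicit modulus of φ is required.
  constructor
  · refine exists_classKInf_le (fun ξ : EucProd n m => ‖ξ - e‖) W (fun _ => norm_nonneg _) hW0
      (fun R => ?_) fun ε hε => ?_
    · obtain ⟨M, hM⟩ := state_bounded_of_lyapunov_bounded hs hf hφ R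
      refine ⟨M + M, fun ξ hξ => (hnorm ξ).trans ?_⟩
      obtain ⟨h1, h2⟩ := hM ξ.fst ξ.snd ((hVs ξ).trans hξ) ((hVf ξ).trans hξ)
      exact add_le_add h1 h2
    · obtain ⟨δ, hδ, h⟩ := state_small_of_lyapunov_small hs hf hφ (half_pos hε)
      refine ⟨δ, hδ, fun ξ hξ => (hnorm ξ).trans ?_⟩
      obtain ⟨h1, h2⟩ := h ξ.fst ξ.snd ((hVs ξ).trans hξ) ((hVf ξ).trans hξ)
      linarith
  · refine exists_classKInf_le W (fun ξ : EucProd n m => ‖ξ - e‖) hW0 (fun _ => norm_nonneg _)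
      (fun R => ?_) fun ε hε => ?_
    · obtain ⟨M, hM⟩ := (isCompact_closedBall e R).exists_bound_of_continuousOn hWc.continuousOn
      exact ⟨M, fun ξ hξ => (le_abs_self _).trans (hM ξ (mem_closedBall_iff_norm.2 hξ))⟩
    · obtain ⟨δ, hδ, h⟩ := Metric.continuousAt_iff.1 (hWc.continuousAt (x := e)) ε hε
      refine ⟨δ / 2, half_pos hδ, fun ξ hξ => ?_⟩
      have := h (x := ξ) (by rw [dist_eq_norm]; linarith)
      rw [hWe, Real.dist_eq, sub_zero] at this
      exact (le_abs_self _).trans this.le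

theorem fderiv_comp_fst {V : Euc n → ℝ} (hV : ContDiff ℝ 1 V) (ξ h : EucProd n m) :
    fderiv ℝ (fun ξ : EucProd n m => V ξ.fst) ξ h = fderiv ℝ V ξ.fst h.fst :=
  fderiv_comp_continuousLinearMap hV (WithLp.fstL 2 ℝ (Euc n) (Euc m)) ξ h

theorem fderiv_comp_snd_fst {V : Euc m → Euc n → ℝ}
    (hV : ContDiff ℝ 1 (fun v : Euc m × Euc n => V v.1 v.2)) (ξ h : EucProd n m) :
    fderiv ℝ (fun ξ : EucProd n m => V ξ.snd ξ.fst) ξ h =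
      fderiv ℝ (fun z => V z ξ.fst) ξ.snd h.snd + fderiv ℝ (fun x => V ξ.snd x) ξ.fst h.fst := by
  refine (fderiv_comp_continuousLinearMap hV
    ((WithLp.sndL 2 ℝ (Euc n) (Euc m)).prod (WithLp.fstL 2 ℝ (Euc n) (Euc m))) ξ h).trans ?_
  exact fderiv_uncurried_apply hV ξ.snd h.snd ξ.fst h.fst

theorem contDiff_comp_fst {V : Euc n → ℝ} (hV : ContDiff ℝ 1 V) :
    ContDiff ℝ 1 (fun ξ : EucProd n m => V ξ.fst) :=
  hV.comp (WithLp.fstL 2 ℝ (Euc n) (Euc m)).contDiff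

theorem contDiff_comp_snd_fst {V : Euc m → Euc n → ℝ}
    (hV : ContDiff ℝ 1 (fun v : Euc m × Euc n => V v.1 v.2)) :
    ContDiff ℝ 1 (fun ξ : EucProd n m => V ξ.snd ξ.fst) :=
  ContDiff.comp (g := fun v : Euc m × Euc n => V v.1 v.2) hV
    ((WithLp.sndL 2 ℝ (Euc n) (Euc m)).prod (WithLp.fstL 2 ℝ (Euc n) (Euc m))).contDiff

end Composite

/-! ### Decay of the composite function and input-to-state stability -/

section InputToState

variable {n m p q : ℕ} {gs : Euc n → Euc m → Euc p → Euc n} {gf : Euc m → Euc n → Euc q → Euc m}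
  {φ : Euc n → Euc m} {Vs : Euc n → ℝ} {Vf : Euc m → Euc n → ℝ}
  {asLow asUp γs χs αs afLow afUp χf αf lf1 lf2 γf ρsUp ρ0 ρsLow : ℝ → ℝ}

/-- The decay rate of the boundary-layer subsystem that is left by the motion of the slow state. -/
theorem classPD_fast_rate (hαf : ClassPD αf) (hlf1 : ClassPD lf1) (hlf2 : ClassPD lf2)
    (hγf : ClassKInf γf) (hρ : ClassP ρsUp)
    (hbal : SpeedBalance γf lf1 lf2 αf ρsUp (fun _ => 1)) :
    ClassPD (fun r => αf r - ρsUp r * (lf1 r + lf2 (kInv γf r))) := by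
  refine ⟨hαf.continuousOn.sub (hρ.continuousOn.mul (hlf1.continuousOn.add
    (hlf2.continuousOn.comp hγf.inv.continuousOn hγf.inv.toClassK.mapsTo))), fun r hr => ?_, ?_⟩
  · have := hbal r hr
    simp only [one_mul] at this
    linarith
  · simp [hαf.zero, hlf1.zero, hγf.inv.zero, hlf2.zero]

theorem ClassPD.mul_classP (hα : ClassPD αs) (hρ : ClassP ρsLow) :
    ClassPD (fun r => ρsLow r * αs r) :=
  ⟨hρ.continuousOn.mul hα.continuousOn, fun r hr => mul_pos (hρ.pos r hr) (hα.pos r hr),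
    by simp [hα.zero]⟩

/-- Along the composite system the fast Lyapunov function decays where it dominates. -/
theorem fast_decay (hs : SlowLyapunov gs Vs Vf asLow asUp γs χs αs)
    (hf : FastLyapunov gf φ Vs Vf afLow afUp χf αf lf1 lf2) (hlf2 : MonotoneOn lf2 (Ici 0))
    (hγf : ClassKInf γf)
    (hbound : FastSpeedBounds gs Vs Vf γf χs χf (fun x z d => ρ0 ‖gs x z d‖)
      (fun (_ : Euc m) (_ : Euc n) (_ : Euc q) => 1) ρsUp (fun _ => 1))
    (hρ0 : ∀ s, 0 ≤ ρ0 s) {x : Euc n} {z : Euc m} {d : Euc p} {w : Euc q}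
    (h : max (γf (Vs x)) (max (γf (χs ‖d‖)) (χf ‖w‖)) ≤ Vf z x) :
    fderiv ℝ (fun z' => Vf z' x) z (gf z x w) +
        fderiv ℝ (fun x' => Vf z x') x (ρ0 ‖gs x z d‖ • gs x z d) ≤
      -(αf (Vf z x) - ρsUp (Vf z x) * (lf1 (Vf z x) + lf2 (kInv γf (Vf z x)))) := by
  have h1 := hf.decay z x w ((le_max_right _ _).trans ((le_max_right _ _).trans h))
  have h2 := (hbound x z d w h).1
  have hVs : Vs x ≤ kInv γf (Vf z x) :=
    hγf.le_kInv (hs.nonneg x) (hf.nonneg z x) ((le_max_left _ _).trans h)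
  have h3 : lf2 (Vs x) ≤ lf2 (kInv γf (Vf z x)) :=
    hlf2 (hs.nonneg x) (hγf.inv.toClassK.nonneg (hf.nonneg z x)) hVs
  -- The drift of V_f caused by x is the cross gradient times the actual slow speed ρ0(|g_s|)|g_s|,
  -- which ρ̄_s(V_f) bounds in this region.
  have h4 : fderiv ℝ (fun x' => Vf z x') x (ρ0 ‖gs x z d‖ • gs x z d) ≤
      ρsUp (Vf z x) * (lf1 (Vf z x) + lf2 (kInv γf (Vf z x))) := by
    refine (Real.le_norm_self _).trans ((ContinuousLinearMap.le_opNorm _ _).trans ?_)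
    rw [norm_smul, Real.norm_of_nonneg (hρ0 _), mul_comm]
    refine mul_le_mul h2 ((hf.cross z x).trans (by linarith)) (norm_nonneg _) ?_
    exact le_trans (mul_nonneg (hρ0 _) (norm_nonneg _)) h2
  linarith

theorem perturbedField_eq_pairField :
    perturbedField gs gf (fun x z d => ρ0 ‖gs x z d‖) (fun _ _ _ => 1) =
      pairField (fun ξ d => ρ0 ‖gs ξ.1 ξ.2 d‖ • gs ξ.1 ξ.2 d) (fun ξ w => gf ξ.2 ξ.1 w) := by
  funext ξ u
  simp [perturbedField, pairField]

/-- Decay of the composite Lyapunov function along solutions, up to the level of the input. -/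
theorem composite_decay
    (h₁ : RegularField (fun (ξ : Euc n × Euc m) (d : Euc p) =>
      ρ0 ‖gs ξ.1 ξ.2 d‖ • gs ξ.1 ξ.2 d))
    (h₂ : RegularField (fun (ξ : Euc n × Euc m) (w : Euc q) => gf ξ.2 ξ.1 w))
    (hs : SlowLyapunov gs Vs Vf asLow asUp γs χs αs)
    (hf : FastLyapunov gf φ Vs Vf afLow afUp χf αf lf1 lf2) (hlf2 : MonotoneOn lf2 (Ici 0))
    (hγf : ClassKInf γf) (hgain : SmallGain γf γs) (hρ : ClassP ρsUp)
    (hbal : SpeedBalance γf lf1 lf2 αf ρsUp (fun _ => 1))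
    (hbound : FastSpeedBounds gs Vs Vf γf χs χf (fun x z d => ρ0 ‖gs x z d‖)
      (fun (_ : Euc m) (_ : Euc n) (_ : Euc q) => 1) ρsUp (fun _ => 1))
    (hρ0 : ∀ s, 0 ≤ ρ0 s) (hlow : ClassP ρsLow)
    (hslow : SlowSpeedLowerBound Vs Vf γs χs (fun x z d => ρ0 ‖gs x z d‖) ρsLow) :
    ∃ ψ, ClassKInf ψ ∧ ∀ (W : EucProd n m → ℝ),
      (W = fun ξ => max (levelFun γf (Vs ξ.fst)) (levelFun (kInv γf) (Vf ξ.snd ξ.fst))) →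
      ∀ (u : ℝ → EucProd p q) (ξ : ℝ → EucProd n m) (T : ℝ), 0 ≤ T → IsInput u →
      IsSolutionOn (pairField (fun ξ d => ρ0 ‖gs ξ.1 ξ.2 d‖ • gs ξ.1 ξ.2 d)
        (fun ξ w => gf ξ.2 ξ.1 w)) u ξ T →
      W (ξ T) ≤ max (kInv ψ (Real.exp (-T) * ψ (W (ξ 0))))
        (max (levelFun γf (χs (inputSup u T)))
          (levelFun (kInv γf) (max (γf (χs (inputSup u T))) (χf (inputSup u T))))) := by
  have hP := hγf.classKInf_levelFun
  have hQ := hγf.inv.classKInf_levelFun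
  have hθs := hs.classPD_αs.mul_classP hlow
  have hθf := classPD_fast_rate hf.classPD_αf hf.classPD_lf1 hf.classPD_lf2 hγf hρ hbal
  set θs := fun r => ρsLow r * αs r
  set θf := fun r => αf r - ρsUp r * (lf1 r + lf2 (kInv γf r))
  -- The inverse level functions recover V_s or V_f from W on the active branch, so both rates
  -- become functions of W; the slower one is kept.
  let a : ℝ → ℝ := fun l => min (θs (kInv (levelFun γf) l)) (θf (kInv (levelFun (kInv γf)) l))
  have hapos : ∀ r, 0 < r → 0 < a r := fun r hr =>
    lt_min (hθs.pos _ (hP.inv.toClassK.pos hr)) (hθf.pos _ (hQ.inv.toClassK.pos hr))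
  have hac : ContinuousOn a (Ioi 0) :=
    ((hθs.continuousOn.comp hP.inv.continuousOn hP.inv.toClassK.mapsTo).inf
      (hθf.continuousOn.comp hQ.inv.continuousOn hQ.inv.toClassK.mapsTo)).mono Ioi_subset_Ici_self
  obtain ⟨ψ, ψ', hψ, hψ'⟩ := exists_classKInf_rescaling a hac hapos
  refine ⟨ψ, hψ, ?_⟩
  rintro W rfl u ξ T hT hu hξ
  set U := inputSup u T with hU
  have hU0 : 0 ≤ U := inputSup_nonneg u T
  have hχs := hs.classKInf_χs.toClassK
  have hχf := hf.classKInf_χf.toClassK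
  have hA : 0 ≤ χs U := hχs.nonneg hU0
  have hB : 0 ≤ max (γf (χs U)) (χf U) := (hχf.nonneg hU0).trans (le_max_right _ _)
  have hVsC := contDiff_comp_fst (m := m) hs.contDiff
  have hVfC := contDiff_comp_snd_fst hf.contDiff
  have hSc : ContinuousOn (fun t => Vs (ξ t).fst) (Icc 0 T) := hVsC.continuous.comp_continuousOn hξ.1
  have hFc : ContinuousOn (fun t => Vf (ξ t).snd (ξ t).fst) (Icc 0 T) :=
    hVfC.continuous.comp_continuousOn hξ.1
  refine dini_decay (W := fun t => max (levelFun γf (Vs (ξ t).fst))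
    (levelFun (kInv γf) (Vf (ξ t).snd (ξ t).fst))) hψ hapos hψ'
    ((hP.toClassK.nonneg hA).trans (le_max_left _ _)) hT
    ((hP.continuousOn.comp hSc fun t _ => hs.nonneg _).sup
      (hQ.continuousOn.comp hFc fun t _ => hf.nonneg _ _)) ?_
  intro t ht hlevel r hr
  refine small_gain_dini hγf hs.classKInf_γs hgain hθs hθf hA hB hSc hFc
    (fun t => hs.nonneg _) (fun t => hf.nonneg _ _) ?_ ?_ ht hlevel hr
  · intro b₁ b₂ c hb₁ hb₁₂ hb₂ hcond
    refine pairField_decrease h₁ h₂ hu hξ hVsC hb₁ hb₁₂ hb₂ fun s hsI v hv => ?_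
    obtain ⟨h3, h4, h5⟩ := hcond s hsI
    rw [fderiv_comp_fst hs.contDiff]
    have hd : ‖v.fst‖ ≤ U := (WithLp.norm_fst_le _ v).trans hv
    have h6 : max (γs (Vf (ξ s).snd (ξ s).fst)) (χs ‖v.fst‖) ≤ Vs (ξ s).fst :=
      max_le h3 ((hχs.strictMono.monotoneOn (mem_Ici.2 (norm_nonneg _)) hU0 hd).trans h4)
    have h7 := hs.decay _ _ _ h6
    have h8 := hslow _ _ _ h6
    have h9 := hs.classPD_αs.nonneg (hs.nonneg (ξ s).fst)
    change fderiv ℝ Vs (ξ s).fst (ρ0 ‖gs (ξ s).fst (ξ s).snd v.fst‖ •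
      gs (ξ s).fst (ξ s).snd v.fst) ≤ -c
    rw [map_smul, smul_eq_mul]
    have h10 := mul_le_mul_of_nonneg_left h7 (hρ0 ‖gs (ξ s).fst (ξ s).snd v.fst‖)
    have h11 := mul_le_mul_of_nonneg_right h8 h9
    have h12 : c ≤ ρsLow (Vs (ξ s).fst) * αs (Vs (ξ s).fst) := h5
    simp only at h11
    linarith
  · intro b₁ b₂ c hb₁ hb₁₂ hb₂ hcond
    refine pairField_decrease h₁ h₂ hu hξ hVfC hb₁ hb₁₂ hb₂ fun s hsI v hv => ?_
    obtain ⟨h3, h4, h5⟩ := hcond s hsI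
    rw [fderiv_comp_snd_fst hf.contDiff]
    have hd : ‖v.fst‖ ≤ U := (WithLp.norm_fst_le _ v).trans hv
    have hw : ‖v.snd‖ ≤ U := (WithLp.norm_snd_le _ v).trans hv
    have hχd := hχs.strictMono.monotoneOn (mem_Ici.2 (norm_nonneg _)) hU0 hd
    have h6 : max (γf (Vs (ξ s).fst)) (max (γf (χs ‖v.fst‖)) (χf ‖v.snd‖)) ≤
        Vf (ξ s).snd (ξ s).fst := by
      refine max_le h3 (le_trans (max_le_max ?_ ?_) h4)
      · exact hγf.strictMono.monotoneOn (hχs.nonneg (norm_nonneg _)) hA hχd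
      · exact hχf.strictMono.monotoneOn (mem_Ici.2 (norm_nonneg _)) hU0 hw
    exact (fast_decay hs hf hlf2 hγf hbound hρ0 h6).trans (neg_le_neg h5)

/-- Sandwiching W between functions of the distance gives β(s, t) = κ₁⁻¹(ψ⁻¹(e⁻ᵗ ψ(κ₂⁻¹(s)))) and χ
= κ₁⁻¹ ∘ ω. The estimate holds for any solution on any finite interval, so its value for t = 0 in β
and for the full horizon in χ is also the a priori bound behind global existence. -/
theorem isISS_of_composite_decay {G₁ : Euc n × Euc m → Euc p → Euc n}
    {G₂ : Euc n × Euc m → Euc q → Euc m} (h₁ : RegularField G₁) (h₂ : RegularField G₂)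
    {e : EucProd n m} {W : EucProd n m → ℝ} {κ₁ κ₂ ψ ω : ℝ → ℝ} (hκ₁ : ClassKInf κ₁)
    (hκ₂ : ClassKInf κ₂) (hψ : ClassKInf ψ) (hω : ClassK ω) (hW0 : ∀ ξ, 0 ≤ W ξ)
    (hW₁ : ∀ ξ, κ₁ ‖ξ - e‖ ≤ W ξ) (hW₂ : ∀ ξ, κ₂ (W ξ) ≤ ‖ξ - e‖)
    (hdec : ∀ (u : ℝ → EucProd p q) (ξ : ℝ → EucProd n m) (T : ℝ), 0 ≤ T → IsInput u →
      IsSolutionOn (pairField G₁ G₂) u ξ T →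
      W (ξ T) ≤ max (kInv ψ (Real.exp (-T) * ψ (W (ξ 0)))) (ω (inputSup u T))) :
    IsISS (pairField G₁ G₂) e := by
  have hA := hκ₁.inv.toClassK.comp hψ.inv.toClassK
  have hB := hψ.toClassK.comp hκ₂.inv.toClassK
  have hβ := hA.classKL_exp hB
  have hχ := hκ₁.inv.toClassK.comp hω
  have key : ∀ (u : ℝ → EucProd p q) (ξ : ℝ → EucProd n m) (T : ℝ), 0 ≤ T → IsInput u →
      IsSolutionOn (pairField G₁ G₂) u ξ T →
      ‖ξ T - e‖ ≤ max (kInv κ₁ (kInv ψ (Real.exp (-T) * ψ (kInv κ₂ ‖ξ 0 - e‖))))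
        (kInv κ₁ (ω (inputSup u T))) := by
    intro u ξ T hT hu hξ
    have h3 : ‖ξ T - e‖ ≤ kInv κ₁ (W (ξ T)) := hκ₁.le_kInv (norm_nonneg _) (hW0 _) (hW₁ _)
    have h4 : W (ξ 0) ≤ kInv κ₂ ‖ξ 0 - e‖ := hκ₂.le_kInv (hW0 _) (norm_nonneg _) (hW₂ _)
    have h5 := hψ.toClassK.nonneg (hW0 (ξ 0))
    have h6 : ψ (W (ξ 0)) ≤ ψ (kInv κ₂ ‖ξ 0 - e‖) :=
      hψ.strictMono.monotoneOn (hW0 _) ((hW0 _).trans h4) h4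
    refine h3.trans ?_
    rcases le_max_iff.1 (hdec u ξ T hT hu hξ) with h | h
    · refine le_max_of_le_left ?_
      have h7 : 0 ≤ Real.exp (-T) * ψ (W (ξ 0)) := by positivity
      have h8 : Real.exp (-T) * ψ (W (ξ 0)) ≤ Real.exp (-T) * ψ (kInv κ₂ ‖ξ 0 - e‖) := by gcongr
      refine (hκ₁.inv.strictMono.monotoneOn (hW0 _) (hψ.inv.toClassK.nonneg h7) h).trans ?_
      exact hA.strictMono.monotoneOn h7 (h7.trans h8) h8
    · exact le_max_of_le_right (hκ₁.inv.strictMono.monotoneOn (hW0 _)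
        (hω.nonneg (inputSup_nonneg _ _)) h)
  refine ⟨_, _, hβ, hχ, fun ξ₀ u hu => ?_, fun u ξ T hu hξ t ht =>
    key u ξ t ht.1 hu (hξ.mono ht.2)⟩
  refine pairField_exists_global_solution h₁ h₂ e u hu ξ₀ fun T =>
    ⟨max (kInv κ₁ (kInv ψ (Real.exp (-0) * ψ (kInv κ₂ ‖ξ₀ - e‖))))
      (kInv κ₁ (ω (inputSup u T))), fun ξ t ht hξ hξ0 => ?_⟩
  have h3 := key u ξ t ht.1 hu hξ
  rw [hξ0] at h3
  exact h3.trans (max_le_max (hβ.le_at_zero (norm_nonneg _) ht.1)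
    (hχ.strictMono.monotoneOn (inputSup_nonneg u t) (inputSup_nonneg u T)
      (hu.inputSup_mono ht.2)))

end InputToState

theorem theorem3 {n m p q : ℕ}
    (gs : Euc n → Euc m → Euc p → Euc n) (gf : Euc m → Euc n → Euc q → Euc m)
    (hreg : StandingRegularity gs gf)
    (φ : Euc n → Euc m) (hφ : SteadyState gs gf φ)
    (hcont : ContinuousAt (fun v : Euc n × Euc m × Euc p => gs v.1 v.2.1 v.2.2) (0, φ 0, 0))
    (Vs : Euc n → ℝ) (Vf : Euc m → Euc n → ℝ)
    (asLow asUp γs χs αs : ℝ → ℝ)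
    (hs : SlowLyapunov gs Vs Vf asLow asUp γs χs αs)
    (afLow afUp χf αf lf1 lf2 : ℝ → ℝ)
    (hf : FastLyapunov gf φ Vs Vf afLow afUp χf αf lf1 lf2)
    (hlf2 : MonotoneOn lf2 (Ici 0))
    (γf : ℝ → ℝ) (hγf : ClassKInf γf) (hgain : SmallGain γf γs)
    (ρsUp : ℝ → ℝ) (hρsUp : ClassP ρsUp) (hρsUp_mono : MonotoneOn ρsUp (Ici 0))
    (hbal : SpeedBalance γf lf1 lf2 αf ρsUp (fun _ => 1)) :
    ∃ ρ0 : ℝ → ℝ, ClassP ρ0 ∧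
      StandingRegularity (fun x z d => ρ0 ‖gs x z d‖ • gs x z d) gf ∧
      (∃ ρsLow : ℝ → ℝ, ClassP ρsLow ∧
        SlowSpeedLowerBound Vs Vf γs χs (fun x z d => ρ0 ‖gs x z d‖) ρsLow) ∧
      SmallGain γf γs ∧
      FastSpeedBounds gs Vs Vf γf χs χf (fun x z d => ρ0 ‖gs x z d‖)
        (fun (_ : Euc m) (_ : Euc n) (_ : Euc q) => 1) ρsUp (fun _ => 1) ∧
      IsISS (perturbedField gs gf (fun x z d => ρ0 ‖gs x z d‖) (fun _ _ _ => 1))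
        (WithLp.toLp 2 (0, φ 0)) := by
  have hφc := hφ.locallyLipschitz.continuous
  obtain ⟨κ, hκL, hκP, hκ0, hκ⟩ :=
    exists_speed_profile hφc hφ.slow hcont hs hf hγf hρsUp hρsUp_mono
  have hρ0 := classP_scaledSpeed hκP
  have hρ0_nonneg : ∀ s, 0 ≤ scaledSpeed κ s := fun s => div_nonneg (hκ0 s) (by positivity)
  obtain ⟨ρsLow, hlow, hslow⟩ := exists_slowSpeedLowerBound hreg.slow hφc hs hf hρ0
  have hreg' := regularField_scaledSpeed hreg.slow hκL hκ0
  have hbound : FastSpeedBounds gs Vs Vf γf χs χf (fun x z d => scaledSpeed κ ‖gs x z d‖)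
      (fun (_ : Euc m) (_ : Euc n) (_ : Euc q) => 1) ρsUp (fun _ => 1) := fun x z d w h =>
    ⟨(scaledSpeed_mul_le hκ0 (norm_nonneg _)).trans (hκ x z d ((le_max_left _ _).trans h)
      ((le_max_left _ _).trans ((le_max_right _ _).trans h))), le_rfl⟩
  refine ⟨scaledSpeed κ, hρ0, ⟨hreg', hreg.fast⟩, ⟨ρsLow, hlow, hslow⟩, hgain, hbound, ?_⟩
  rw [perturbedField_eq_pairField]
  obtain ⟨ψ, hψ, hdec⟩ := composite_decay hreg' hreg.fast hs hf hlf2 hγf hgain hρsUp hbal hbound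
    hρ0_nonneg hlow hslow
  obtain ⟨⟨κ₁, hκ₁, hW₁⟩, κ₂, hκ₂, hW₂⟩ := exists_classKInf_composite_bounds hφc hs hf hγf rfl
  have hχs := hs.classKInf_χs.toClassK
  have hω := (hγf.classKInf_levelFun.toClassK.comp hχs).sup
    (hγf.inv.classKInf_levelFun.toClassK.comp
      ((hγf.toClassK.comp hχs).sup hf.classKInf_χf.toClassK))
  exact isISS_of_composite_decay hreg' hreg.fast hκ₁ hκ₂ hψ hω
    (fun ξ => (hγf.classKInf_levelFun.toClassK.nonneg (hs.nonneg _)).trans (le_max_left _ _))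
    hW₁ hW₂ (hdec _ rfl)
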